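/- For $z$ in the upper half-plane let $q=e^{2\pi i z}$, $\eta(z)=q^{1/24}\prod_{n\ge1}(1-q^n)$, $D_2(z)=\eta(2z)^{12}$ and $F(z)=\eta(4z)^8/\eta(2z)^4$. Let $\widetilde M^{(3)}(\Gamma_0(4))\subseteq\mathbb F_3[[q]]$ be the sum, over all integers $k$, of the spaces of reductions modulo $3$ of $q$-expansions of holomorphic modular forms of weight $k$ on $\Gamma_0(4)$ with $3$-integral rational coefficients, and write $D_2, F$ also for the reductions modulo $3$ of their $q$-expansions. For a prime $\ell\ne 2,3$ let $T_\ell$ be the Hecke operator, which in weight $k$ is $\sum c(n)q^n\mapsto\sum\big(c(\ell n)+\ell^{k-1}c(n/\ell)\big)q^n$ with $c(n/\ell)=0$ if $\ell\nmid n$ (modulo $3$ it does not depend on $k$, since all weights are even: it is $\sum c(n)q^n\mapsto\sum(c(\ell n)+\ell c(n/\ell))q^n$). Let $T'_\ell=T_\ell-2$ if $\ell\equiv1\pmod 3$ and $T'_\ell=T_\ell$ if $\ell\equiv-1\pmod 3$. Put $$W_1=\mathrm{Span}_{\mathbb F_3}\{D_2^k,\ D_2^iF^3 : k,i\ge 0,\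 k\equiv1,\ i\equiv4 \pmod 6\},\qquad W_5=\mathrm{Span}_{\mathbb F_3}\{D_2^k,\ D_2^iF^3 : k,i\ge 0,\ k\equiv5,\ i\equiv2\pmod 6\}.$$ Then $W_1$ and $W_5$ are subspaces of $\widetilde M^{(3)}(\Gamma_0(4))$. For every prime $\ell\equiv1\pmod 6$, $T'_\ell(W_1)\subseteq W_1$ and $T'_\ell(W_5)\subseteq W_5$. For every prime $\ell\equiv-1\pmod 6$, $T'_\ell(W_1)\subseteq W_5$ and $T'_\ell(W_5)\subseteq W_1$. -/

import Mathlib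

open scoped UpperHalfPlane MatrixGroups

noncomputable section

namespace ModThree

/-- The congruence subgroup `Γ₀(N)` of `SL(2, ℤ)`, viewed inside `GL(2, ℝ)`. -/
abbrev Gamma0GL (N : ℕ) : Subgroup (GL (Fin 2) ℝ) :=
  (CongruenceSubgroup.Gamma0 N).map (Matrix.SpecialLinearGroup.mapGL ℝ)

/-- A complex number is `p`-integral if it is a rational number whose denominator is
prime to `p`. -/
def IsPIntegral (p : ℕ) (x : ℂ) : Prop :=
  ∃ r : ℚ, (r : ℂ) = x ∧ ¬ p ∣ r.den

open Classical in
/-- Reduction modulo `p` of a `p`-integral complex number (and `0` on all other numbers). -/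
def redCoeff (p : ℕ) [Fact p.Prime] (x : ℂ) : ZMod p :=
  if h : IsPIntegral p x then ((h.choose : ℚ) : ZMod p) else 0

/-- Coefficientwise reduction modulo `p` of a power series. -/
def redSeries (p : ℕ) [Fact p.Prime] (g : PowerSeries ℂ) : PowerSeries (ZMod p) :=
  PowerSeries.mk fun n => redCoeff p (PowerSeries.coeff n g)

/-- `M̃_k^{(p)}(Γ₀(N))`: the space of reductions modulo `p` of `q`-expansions of holomorphic
modular forms of weight `k` on `Γ₀(N)` with `p`-integral coefficients. -/
def modFormsModWeight (p : ℕ) [Fact p.Prime] (N : ℕ) (k : ℤ) :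
    Submodule (ZMod p) (PowerSeries (ZMod p)) :=
  Submodule.span (ZMod p)
    {φ | ∃ f : ModularForm (Gamma0GL N) k,
      (∀ n : ℕ, IsPIntegral p (PowerSeries.coeff n (UpperHalfPlane.qExpansion 1 (f : ℍ → ℂ)))) ∧
      φ = redSeries p (UpperHalfPlane.qExpansion 1 (f : ℍ → ℂ))}

/-- `M̃^{(p)}(Γ₀(N))`: the sum of the spaces `M̃_k^{(p)}(Γ₀(N))` over all integer weights `k`. -/
def modFormsMod (p : ℕ) [Fact p.Prime] (N : ℕ) :
    Submodule (ZMod p) (PowerSeries (ZMod p)) :=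
  ⨆ k : ℤ, modFormsModWeight p N k

/-- The function `D₂(z) = η(2z)¹²`. -/
def D2 (z : ℍ) : ℂ := ModularForm.eta (2 * (z : ℂ)) ^ 12

/-- The function `F(z) = η(4z)⁸ / η(2z)⁴`. -/
def F (z : ℍ) : ℂ := ModularForm.eta (4 * (z : ℂ)) ^ 8 / ModularForm.eta (2 * (z : ℂ)) ^ 4

/-- The `q`-expansion of `D₂` modulo `3`. -/
def D2bar : PowerSeries (ZMod 3) := redSeries 3 (UpperHalfPlane.qExpansion 1 D2)

/-- The `q`-expansion of `F` modulo `3`. -/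
def Fbar : PowerSeries (ZMod 3) := redSeries 3 (UpperHalfPlane.qExpansion 1 F)

/-- The span over `𝔽₃` of all `D₂ᵏ` with `k ≡ 1 (mod 6)` and all `D₂ⁱ F³` with
`i ≡ 4 (mod 6)`. -/
def W1 : Submodule (ZMod 3) (PowerSeries (ZMod 3)) :=
  Submodule.span (ZMod 3)
    ({φ | ∃ k : ℕ, k ≡ 1 [MOD 6] ∧ φ = D2bar ^ k} ∪
      {φ | ∃ i : ℕ, i ≡ 4 [MOD 6] ∧ φ = D2bar ^ i * Fbar ^ 3})

/-- The span over `𝔽₃` of all `D₂ᵏ` with `k ≡ 5 (mod 6)` and all `D₂ⁱ F³` with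
`i ≡ 2 (mod 6)`. -/
def W5 : Submodule (ZMod 3) (PowerSeries (ZMod 3)) :=
  Submodule.span (ZMod 3)
    ({φ | ∃ k : ℕ, k ≡ 5 [MOD 6] ∧ φ = D2bar ^ k} ∪
      {φ | ∃ i : ℕ, i ≡ 2 [MOD 6] ∧ φ = D2bar ^ i * Fbar ^ 3})

/-- The Hecke operator `T_ℓ` in weight `k` on `q`-expansions:
`∑ c(n) qⁿ ↦ ∑ (c(ℓ n) + ℓ^(k-1) c(n/ℓ)) qⁿ`, where `c(n/ℓ) = 0` if `ℓ ∤ n`. -/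
def heckeWeight (K : Type*) [Field K] (k : ℤ) (l : ℕ) : PowerSeries K →ₗ[K] PowerSeries K where
  toFun f := PowerSeries.mk fun n =>
    PowerSeries.coeff (l * n) f +
      (l : K) ^ (k - 1) * (if l ∣ n then PowerSeries.coeff (n / l) f else 0)
  map_add' f g := by
    ext n
    by_cases h : l ∣ n
    · simp [h]; ring
    · simp [h]
  map_smul' a f := by
    ext n
    by_cases h : l ∣ n
    · simp [h]; ring
    · simp [h]

/-- The Hecke operator `T_ℓ` on `q`-expansions modulo `3` of forms on `Γ₀(4)`,
`∑ c(n) qⁿ ↦ ∑ (c(ℓ n) + ℓ c(n/ℓ)) qⁿ`. All weights on `Γ₀(4)` are even and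
`ℓ² = 1` in `𝔽₃` for `ℓ ≠ 3`, so this is the operator `T_ℓ` of every weight at once;
see `heckeT_eq_heckeWeight`. -/
def heckeT (l : ℕ) : PowerSeries (ZMod 3) →ₗ[ZMod 3] PowerSeries (ZMod 3) :=
  heckeWeight (ZMod 3) 2 l

/-- The modified Hecke operator: `T'_ℓ = T_ℓ - 2` if `ℓ ≡ 1 (mod 3)`, and `T'_ℓ = T_ℓ` if
`ℓ ≡ -1 (mod 3)`. -/
def heckeT' (l : ℕ) : PowerSeries (ZMod 3) →ₗ[ZMod 3] PowerSeries (ZMod 3) :=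
  if l ≡ 1 [MOD 3] then heckeT l - (2 : ZMod 3) • LinearMap.id else heckeT l

lemma redCoeff_ratCast (p : ℕ) [Fact p.Prime] (r : ℚ) (hr : ¬ p ∣ r.den) :
    redCoeff p (r : ℂ) = (r : ZMod p) := by
  have h : IsPIntegral p (r : ℂ) := ⟨r, rfl, hr⟩
  have h2 : h.choose = r := Rat.cast_injective (α := ℂ) h.choose_spec.1
  rw [redCoeff, dif_pos h, h2]

/-- In even weight, `T_ℓ` modulo `3` does not depend on the weight. -/
lemma heckeWeight_even (k : ℤ) (hk : Even k) (l : ℕ) (hl : ¬ 3 ∣ l) :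
    heckeWeight (ZMod 3) k l = heckeT l := by
  have h0 : (l : ZMod 3) ≠ 0 := by rwa [Ne, ZMod.natCast_eq_zero_iff]
  have hsq : (l : ZMod 3) ^ (2 : ℤ) = 1 := by
    have := ZMod.pow_card_sub_one_eq_one h0
    exact_mod_cast this
  have hpow : (l : ZMod 3) ^ (k - 1) = (l : ZMod 3) ^ ((2 : ℤ) - 1) := by
    obtain ⟨m, rfl⟩ := hk
    have : m + m - 1 = 2 * (m - 1) + (2 - 1) := by ring
    rw [this, zpow_add₀ h0, zpow_mul, hsq, one_zpow, one_mul]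
  ext f n
  simp [heckeWeight, heckeT, hpow]

lemma modFormsModWeight_odd (p : ℕ) [Fact p.Prime] (N : ℕ) (k : ℤ) (hk : Odd k) :
    modFormsModWeight p N k = ⊥ := by
  rw [modFormsModWeight, Submodule.span_eq_bot]
  rintro φ ⟨f, -, rfl⟩
  have hneg : (-1 : GL (Fin 2) ℝ) ∈ Gamma0GL N := by
    refine ⟨-1, by simp [CongruenceSubgroup.Gamma0_mem], ?_⟩
    ext i j
    fin_cases i <;> fin_cases j <;> simp
  have hf : f = 0 := f.eq_zero_of_neg_one_mem hneg hk
  subst hf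
  ext n
  have hz : ((0 : ModularForm (Gamma0GL N) k) : ℍ → ℂ) = 0 := rfl
  have h := redCoeff_ratCast p 0 (by simpa using (Fact.out : p.Prime).one_lt.ne')
  rw [hz, UpperHalfPlane.qExpansion_zero]
  simpa [redSeries] using h

/-- The operator `heckeT` agrees with the Hecke operator of weight `k` on
`M̃_k^{(3)}(Γ₀(4))`, for every weight `k`. -/
lemma heckeT_eq_heckeWeight (k : ℤ) (l : ℕ) (hl : ¬ 3 ∣ l) (f : PowerSeries (ZMod 3))
    (hf : f ∈ modFormsModWeight 3 4 k) : heckeT l f = heckeWeight (ZMod 3) k l f := by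
  rcases Int.even_or_odd k with hk | hk
  · rw [heckeWeight_even k hk l hl]
  · rw [modFormsModWeight_odd 3 4 k hk, Submodule.mem_bot] at hf
    simp [hf]

/-- In weight `k ≥ 1`, reducing `g | T_ℓ` modulo `p` gives the Hecke operator of the same
weight applied to the reduction of `g`. -/
lemma redSeries_heckeWeight (p : ℕ) [Fact p.Prime] (k : ℤ) (hk : 1 ≤ k) (l : ℕ)
    (g : PowerSeries ℂ) (hg : ∀ n : ℕ, IsPIntegral p (PowerSeries.coeff n g)) :
    redSeries p (heckeWeight ℂ k l g) = heckeWeight (ZMod p) k l (redSeries p g) := by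
  have hp : p.Prime := Fact.out
  choose r hr hd using hg
  obtain ⟨m, hm⟩ : ∃ m : ℕ, k - 1 = m := ⟨(k - 1).toNat, by omega⟩
  have hred : ∀ n, redCoeff p (PowerSeries.coeff n g) = (r n : ZMod p) := fun n => by
    rw [← hr n, redCoeff_ratCast p _ (hd n)]
  have hne : ∀ q : ℚ, ¬ p ∣ q.den → ((q.den : ℕ) : ZMod p) ≠ 0 := fun q hq => by
    rwa [Ne, ZMod.natCast_eq_zero_iff]
  ext n
  by_cases h : l ∣ n
  · have hden : ¬ p ∣ (((l ^ m : ℕ) : ℚ) * r (n / l)).den := fun hdvd => by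
      have := hdvd.trans (Rat.mul_den_dvd _ _)
      rw [Rat.den_natCast, one_mul] at this
      exact hd _ this
    have hsum : ¬ p ∣ (r (l * n) + ((l ^ m : ℕ) : ℚ) * r (n / l)).den := fun hdvd =>
      (hp.dvd_mul.1 (hdvd.trans (Rat.add_den_dvd _ _))).elim (hd _) hden
    have hc := redCoeff_ratCast p _ hsum
    rw [Rat.cast_add_of_ne_zero (hne _ (hd _)) (hne _ hden),
      Rat.cast_mul_of_ne_zero (by simp) (hne _ (hd _))] at hc
    simp only [redSeries, heckeWeight, LinearMap.coe_mk, AddHom.coe_mk, PowerSeries.coeff_mk,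
      if_pos h, hm, zpow_natCast, hred]
    rw [← hr, ← hr]
    push_cast at hc ⊢
    exact hc
  · simp [redSeries, heckeWeight, h]

end ModThree

end

/-!
The functions `D₂(z)` and `F(z)` are `delta(2z)` and `alpha(2z)`, where `delta = η(z)¹²` and
`alpha = η(2z)⁸/η(z)⁴` are modular forms of weights six and two for `Γ(2)`. Substitution of `2z`
identifies forms for `Γ(2)`, expanded in powers of `q = exp(π i z)`, with forms for `Γ₀(4)`, and
the proof takes place on `Γ(2)`, because that group is normal in `SL(2, ℤ)` and the Hecke
operators commute with the action of `SL(2, ℤ)` (`heckeOp_slash`).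

A form of weight `2m` for `Γ(2)` with integral expansion is an integral homogeneous polynomial of
degree `m` in `alpha` and the Eisenstein series `eis = 2E₂(2z) - E₂(z)`
(`IsGammaTwoForm.exists_eq_sum`): subtract a multiple of a power of `eis` to get a zero at `i∞`,
and divide by `alpha`, whose only zero is a simple one at `i∞`. Since `eis ≡ 1` modulo `3`, the
reduction of the form is a polynomial `p(F)`. In particular `D₂ ≡ F - F³` (`deltaMod_eq`).

The element `ST` of `SL(2, ℤ)` acts on `Γ(2)`-forms with order three. It fixes `delta`, and
`alpha` and `eis` have trace zero for this action, so that all `delta ^ k * alpha` and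
`delta ^ k * eis` have trace zero, and so have their images under the Hecke operators. Modulo `3`
the action of `ST` on `p(F)` becomes the translation `F ↦ F - 1`, so a form of trace zero
satisfies `p(F) + p(F - 1) + p(F + 1) = 0` (`sum_translates_eq_zero`). As `F - F³` is invariant under these
translations, writing `p(F) = u(D₂) + v(D₂) F + w(D₂) F²` gives `2 w(D₂) = 0`. Hence the span of
all `D₂ᵏ` and `D₂ᵏ F`, which is that of all `D₂ᵏ` and `D₂ᵏ F³`, is stable under the Hecke
operators (`heckeT_mem_stableSpan`).

Finally `D₂` and `F³` contain modulo `3` only exponents congruent to `1` and to `3` modulo `6`,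
so `W1` and `W5` are the parts of this span with exponents congruent to `1` and `5` modulo `6`.
The operator `T_l` multiplies the residue class of the exponents by `l`, which gives the result
(`heckeT_mem_classPart`).
-/

noncomputable section

namespace ModThree

open PowerSeries Filter Topology UpperHalfPlane Function ModularGroup CongruenceSubgroup
open ModularForm (eta)
open EisensteinSeries (E2)
open scoped Manifold ModularForm

/-! ### Evaluation of power series -/

/-- `SumsTo P q s` says that the power series `P` converges at the point `q`, with sum `s`. -/
def SumsTo (P : PowerSeries ℂ) (q s : ℂ) : Prop :=
  HasSum (fun n => coeff n P * q ^ n) s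

/-- The complex power series underlying an integral one. -/
abbrev toC : PowerSeries ℤ →+* PowerSeries ℂ := PowerSeries.map (Int.castRingHom ℂ)

lemma toC_injective : Function.Injective toC := fun P Q h => by
  ext n
  have := congrArg (coeff n) h
  simpa using this

namespace SumsTo

variable {P Q : PowerSeries ℂ} {q s t : ℂ}

lemma of_hasSum {u : ℕ → ℂ} (h : HasSum u s) (hu : ∀ n, coeff n P * q ^ n = u n) :
    SumsTo P q s := by
  rwa [SumsTo, funext hu]

lemma unique (h : SumsTo P q s) (h' : SumsTo P q t) : s = t := HasSum.unique h h'

lemma add (hP : SumsTo P q s) (hQ : SumsTo Q q t) : SumsTo (P + Q) q (s + t) := by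
  simpa [SumsTo, add_mul] using HasSum.add hP hQ

lemma sub (hP : SumsTo P q s) (hQ : SumsTo Q q t) : SumsTo (P - Q) q (s - t) := by
  simpa [SumsTo, sub_mul] using HasSum.sub hP hQ

lemma const (c q : ℂ) : SumsTo (C c) q c := by
  have : (fun n => coeff n (C c) * q ^ n) = fun n => if n = 0 then c else 0 := by
    funext n
    rw [coeff_C]
    split_ifs with h <;> simp [h]
  rw [SumsTo, this]
  simpa using hasSum_ite_eq (0 : ℕ) c

lemma X (q : ℂ) : SumsTo X q q := by
  have : (fun n => coeff n (PowerSeries.X : PowerSeries ℂ) * q ^ n)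
      = fun n => if n = 1 then q else 0 := by
    funext n
    rw [coeff_X]
    split_ifs with h <;> simp [h]
  rw [SumsTo, this]
  simpa using hasSum_ite_eq (1 : ℕ) q

lemma mul (hP : SumsTo P q s) (hQ : SumsTo Q q t) : SumsTo (P * Q) q (s * t) := by
  have h := (summable_norm_sum_mul_antidiagonal_of_summable_norm hP.summable.norm
    hQ.summable.norm).of_norm.hasSum
  rw [← tsum_mul_tsum_eq_tsum_sum_antidiagonal_of_summable_norm hP.summable.norm
    hQ.summable.norm, HasSum.tsum_eq hP, HasSum.tsum_eq hQ] at h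
  refine of_hasSum h fun n => ?_
  rw [coeff_mul, Finset.sum_mul]
  refine Finset.sum_congr rfl fun ij hij => ?_
  rw [← Finset.HasAntidiagonal.mem_antidiagonal.1 hij, pow_add]
  ring

lemma one (q : ℂ) : SumsTo 1 q 1 := by simpa using const 1 q

lemma pow (hP : SumsTo P q s) (k : ℕ) : SumsTo (P ^ k) q (s ^ k) := by
  induction k with
  | zero => simpa using one q
  | succ k ih => simpa [pow_succ] using ih.mul hP

lemma const_mul (c : ℂ) (hP : SumsTo P q s) : SumsTo (C c * P) q (c * s) := (const c q).mul hP

lemma sum {ι : Type*} (I : Finset ι) {P : ι → PowerSeries ℂ} {s : ι → ℂ}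
    (h : ∀ i ∈ I, SumsTo (P i) q (s i)) : SumsTo (∑ i ∈ I, P i) q (∑ i ∈ I, s i) := by
  classical
  induction I using Finset.induction_on with
  | empty => simpa using const 0 q
  | insert i I hi ih =>
    rw [Finset.sum_insert hi, Finset.sum_insert hi]
    exact (h i (by simp)).add (ih fun j hj => h j (by simp [hj]))

lemma prod {ι : Type*} (I : Finset ι) {P : ι → PowerSeries ℂ} {s : ι → ℂ}
    (h : ∀ i ∈ I, SumsTo (P i) q (s i)) : SumsTo (∏ i ∈ I, P i) q (∏ i ∈ I, s i) := by
  classical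
  induction I using Finset.induction_on with
  | empty => simpa using one q
  | insert i I hi ih =>
    rw [Finset.prod_insert hi, Finset.prod_insert hi]
    exact (h i (by simp)).mul (ih fun j hj => h j (by simp [hj]))

lemma expand {k : ℕ} (hk : k ≠ 0) (hP : SumsTo P (q ^ k) s) :
    SumsTo (PowerSeries.expand k hk P) q s := by
  have hinj : Function.Injective fun n : ℕ => k * n := fun a b h =>
    Nat.eq_of_mul_eq_mul_left (Nat.pos_of_ne_zero hk) h
  rw [SumsTo, ← hinj.hasSum_iff]
  · rw [SumsTo] at hP
    convert hP using 2 with n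
    simp [coeff_expand_mul, pow_mul]
  · intro n hn
    rw [coeff_expand_of_not_dvd, zero_mul]
    rintro ⟨m, rfl⟩
    exact hn ⟨m, rfl⟩

end SumsTo

/-- Differentiable functions on the unit disc are sums of power series. -/
lemma exists_sumsTo {g : ℂ → ℂ} (hg : DifferentiableOn ℂ g (Metric.ball 0 1)) :
    ∃ P : PowerSeries ℂ, ∀ q : ℂ, ‖q‖ < 1 → SumsTo P q (g q) := by
  refine ⟨PowerSeries.mk fun n => (n.factorial : ℂ)⁻¹ * iteratedDeriv n g 0, fun q hq => ?_⟩
  have := Complex.hasSum_taylorSeries_on_ball (c := 0) (r := 1) (by simpa using hg)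
    (z := q) (by simpa using hq)
  refine SumsTo.of_hasSum this fun n => ?_
  simp only [coeff_mk, smul_eq_mul, sub_zero]
  ring

lemma coeff_eq_iteratedDeriv {P : PowerSeries ℂ} {g : ℂ → ℂ}
    (h : ∀ q : ℂ, ‖q‖ < 1 → SumsTo P q (g q)) (n : ℕ) :
    coeff n P = (n.factorial : ℂ)⁻¹ * iteratedDeriv n g 0 := by
  have hf : HasFPowerSeriesOnBall g (.ofScalars ℂ fun n => coeff n P) 0 1 := by
    constructor
    · refine le_of_forall_lt_imp_le_of_dense fun r hr ↦ ?_
      lift r to NNReal using hr.ne_top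
      apply FormalMultilinearSeries.le_radius_of_summable
      have := (h r (by simpa using hr)).summable.norm
      simpa [norm_mul, mul_comm] using this
    · simp
    · intro y hy
      rw [← ENNReal.coe_one, Metric.eball_coe, NNReal.coe_one, mem_ball_zero_iff] at hy
      simpa [SumsTo, mul_comm] using h y hy
  have := hf.hasFPowerSeriesAt.eq_formalMultilinearSeries
    (hf.analyticAt.hasFPowerSeriesAt)
  have h2 := congrArg (fun p => p.coeff n) this
  simp only [FormalMultilinearSeries.coeff_ofScalars] at h2
  rw [h2]
  field_simp

/-- Power series with equal sums on the punctured unit disc are equal. -/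
lemma eq_of_sumsTo {P Q : PowerSeries ℂ}
    (h : ∀ q : ℂ, ‖q‖ < 1 → q ≠ 0 → ∃ s, SumsTo P q s ∧ SumsTo Q q s) : P = Q := by
  -- after multiplication by `X` the sums also agree at `0`
  choose! s hs using h
  have hX : ∀ R : PowerSeries ℂ, (∀ q : ℂ, ‖q‖ < 1 → q ≠ 0 → SumsTo R q (s q)) →
      ∀ q : ℂ, ‖q‖ < 1 → SumsTo (PowerSeries.X * R) q (q * s q) := by
    intro R hR q hq
    rcases eq_or_ne q 0 with rfl | h0
    · have h00 : (fun n => coeff n (PowerSeries.X * R) * (0 : ℂ) ^ n) = fun _ => 0 := by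
        funext n
        cases n with
        | zero => simp
        | succ n => simp
      rw [SumsTo, h00, zero_mul]
      exact hasSum_zero
    · exact (SumsTo.X q).mul (hR q hq h0)
  have : PowerSeries.X * P = PowerSeries.X * Q := by
    ext n
    rw [coeff_eq_iteratedDeriv (hX P fun q hq h0 => (hs q hq h0).1),
      coeff_eq_iteratedDeriv (hX Q fun q hq h0 => (hs q hq h0).2)]
  exact mul_left_cancel₀ PowerSeries.X_ne_zero this

/-! ### The Euler function -/

lemma tendstoLocallyUniformlyOn_iteratedDeriv {ι : Type*} {l : Filter ι} {F : ι → ℂ → ℂ}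
    {f : ℂ → ℂ} {U : Set ℂ} (hU : IsOpen U) (hf : TendstoLocallyUniformlyOn F f l U)
    (hF : ∀ i, DifferentiableOn ℂ (F i) U) (n : ℕ) :
    TendstoLocallyUniformlyOn (fun i => iteratedDeriv n (F i)) (iteratedDeriv n f) l U ∧
      ∀ i, DifferentiableOn ℂ (iteratedDeriv n (F i)) U := by
  induction n with
  | zero => simpa using ⟨hf, hF⟩
  | succ n ih =>
    simp only [iteratedDeriv_succ]
    exact ⟨ih.1.deriv (Eventually.of_forall ih.2) hU, fun i => (ih.2 i).deriv hU⟩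

/-- The Euler function `∏ (1 - qⁿ)` is the sum of an integral power series on the unit disc. -/
lemma sumsTo_pentagonalSeries {q : ℂ} (hq : ‖q‖ < 1) :
    SumsTo (toC (pentagonalSeries ℤ)) q (∏' n : ℕ, (1 - q ^ (n + 1))) := by
  have hdiff := ModularForm.differentiableOn_tprod_one_sub_pow
  obtain ⟨P, hP⟩ := exists_sumsTo hdiff
  suffices P = toC (pentagonalSeries ℤ) from this ▸ hP q hq
  ext n
  rw [coeff_eq_iteratedDeriv hP]
  -- the Taylor coefficients of the partial products converge to those of the product
  have hlim := ModularForm.multipliableLocallyUniformlyOn_one_sub_pow.hasProdLocallyUniformlyOn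
  have hder := (tendstoLocallyUniformlyOn_iteratedDeriv Metric.isOpen_ball hlim (fun s => by
    simp only
    fun_prop) n).1.tendsto_at (Metric.mem_ball_self one_pos)
  have hpart : ∀ s : Finset ℕ, ∀ q : ℂ, ‖q‖ < 1 →
      SumsTo (toC (∏ i ∈ s, (1 - PowerSeries.X ^ (i + 1)))) q
        ((fun q => ∏ i ∈ s, (1 - q ^ (i + 1))) q) := by
    intro s q _
    rw [map_prod]
    refine SumsTo.prod s fun i _ => ?_
    simpa using (SumsTo.one q).sub ((SumsTo.X q).pow (i + 1))
  have hev := PowerSeries.coeff_prod_one_sub_X_pow_eventually_eq ℤ n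
  have hder' := hder.const_mul (n.factorial : ℂ)⁻¹
  refine tendsto_nhds_unique hder' (tendsto_const_nhds.congr' ?_)
  filter_upwards [hev] with s hs
  have := coeff_eq_iteratedDeriv (hpart s) n
  simp only [coeff_map] at this ⊢
  rw [hs] at this
  simpa using this

/-! ### Fourier expansions of period two -/

/-- `f(z) = ∑ c(n) qⁿ` with `q = exp(π i z)`, where `c(n)` are the coefficients of `P`. -/
def HasQ (f : ℍ → ℂ) (P : PowerSeries ℂ) : Prop :=
  ∀ z : ℍ, SumsTo P (Periodic.qParam 2 z) (f z)

lemma norm_qParam_two_lt_one (z : ℍ) : ‖Periodic.qParam 2 z‖ < 1 :=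
  Periodic.norm_qParam_lt_one two_pos z.im_pos

lemma qParam_two_two_vadd (z : ℍ) :
    Periodic.qParam 2 ((2 : ℝ) +ᵥ z : ℍ) = Periodic.qParam 2 z := by
  have : (2 * Real.pi * Complex.I * ((2 : ℂ) + z) / 2)
      = 2 * Real.pi * Complex.I * z / 2 + 2 * Real.pi * Complex.I := by ring
  simp [Periodic.qParam, UpperHalfPlane.coe_vadd, this, Complex.exp_add]

namespace HasQ

variable {f g : ℍ → ℂ} {P Q : PowerSeries ℂ}

lemma add (hf : HasQ f P) (hg : HasQ g Q) : HasQ (f + g) (P + Q) := fun z => (hf z).add (hg z)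

lemma sub (hf : HasQ f P) (hg : HasQ g Q) : HasQ (f - g) (P - Q) := fun z => (hf z).sub (hg z)

lemma mul (hf : HasQ f P) (hg : HasQ g Q) : HasQ (f * g) (P * Q) := fun z => (hf z).mul (hg z)

lemma pow (hf : HasQ f P) (n : ℕ) : HasQ (f ^ n) (P ^ n) := fun z => (hf z).pow n

lemma smul (c : ℂ) (hf : HasQ f P) : HasQ (c • f) (C c * P) := fun z => (hf z).const_mul c

lemma sum {ι : Type*} (I : Finset ι) {f : ι → ℍ → ℂ} {P : ι → PowerSeries ℂ}
    (h : ∀ i ∈ I, HasQ (f i) (P i)) : HasQ (∑ i ∈ I, f i) (∑ i ∈ I, P i) := fun z => by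
  rw [Finset.sum_apply]
  exact SumsTo.sum I fun i hi => h i hi z

lemma unique (hP : HasQ f P) (hQ : HasQ f Q) : P = Q := by
  refine eq_of_sumsTo fun q hq h0 => ?_
  have him := Periodic.im_invQParam_pos_of_norm_lt_one (h := 2) two_pos hq h0
  refine ⟨f ⟨_, him⟩, ?_, ?_⟩
  · have := hP ⟨_, him⟩
    rwa [UpperHalfPlane.coe_mk, Periodic.qParam_right_inv two_ne_zero h0] at this
  · have := hQ ⟨_, him⟩
    rwa [UpperHalfPlane.coe_mk, Periodic.qParam_right_inv two_ne_zero h0] at this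

lemma isBounded (hf : HasQ f P) : IsBoundedAtImInfty f :=
  isBoundedAtImInfty_of_hasSum_qExpansion (h := 2) two_pos
    (c := fun n => coeff n P) (fun z => by simpa [SumsTo] using hf z)

lemma two_vadd (hf : HasQ f P) (z : ℍ) : f ((2 : ℝ) +ᵥ z) = f z :=
  (hf _).unique (by rw [qParam_two_two_vadd]; exact hf z)

lemma div_qParam (hf : HasQ f (PowerSeries.X * P)) :
    HasQ (fun z => f z / Periodic.qParam 2 z) P := by
  intro z
  have hq : Periodic.qParam 2 z ≠ 0 := Periodic.qParam_ne_zero _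
  have h2 : HasSum (fun n => coeff n (PowerSeries.X * P) * Periodic.qParam 2 z ^ n) (f z) := hf z
  rw [← hasSum_nat_add_iff' 1] at h2
  simp only [coeff_succ_X_mul] at h2
  have h3 := h2.div_const (Periodic.qParam 2 z)
  refine SumsTo.of_hasSum (by simpa using h3) fun n => ?_
  rw [pow_succ]
  field_simp

/-- A function tends at `i∞` to the constant term of its expansion. -/
lemma tendsto (hf : HasQ f P) : Tendsto f atImInfty (𝓝 (coeff 0 P)) := by
  obtain ⟨R, hR⟩ := (PowerSeries.X_dvd_iff (φ := P - C (coeff 0 P))).2 (by simp)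
  set g : ℍ → ℂ := fun z => (f z - coeff 0 P) / Periodic.qParam 2 z
  have hg : HasQ g R := by
    refine div_qParam (f := fun z => f z - coeff 0 P) fun z => ?_
    exact hR ▸ (hf z).sub (SumsTo.const _ _)
  have hz : IsZeroAtImInfty fun z : ℍ => Periodic.qParam 2 z :=
    qParam_tendsto_atImInfty (h := 2) two_pos
  have hprod : Tendsto (fun z : ℍ => Periodic.qParam 2 z * g z) atImInfty (𝓝 0) :=
    Filter.ZeroAtFilter.mul_boundedAtFilter hz hg.isBounded
  have : f = fun z : ℍ => Periodic.qParam 2 z * g z + coeff 0 P := by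
    funext z
    have hq : Periodic.qParam 2 z ≠ 0 := Periodic.qParam_ne_zero _
    simp only [g]
    field_simp
    ring
  rw [this]
  simpa using hprod.add_const (coeff 0 P)

end HasQ

lemma periodic_comp_ofComplex_of_vadd {f : ℍ → ℂ} (hf : ∀ z, f ((2 : ℝ) +ᵥ z) = f z) :
    Periodic (f ∘ ofComplex) ((2 : ℝ) : ℂ) := by
  intro w
  by_cases! hw : 0 < w.im
  · have : ofComplex (w + (2 : ℝ)) = (2 : ℝ) +ᵥ ofComplex w := by
      rw [ofComplex_apply_of_im_pos hw, ofComplex_apply_of_im_pos (by simpa using hw)]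
      ext
      simp [UpperHalfPlane.coe_vadd, add_comm]
    simp only [comp_apply, this, hf]
  · have h1 : (w + ((2 : ℝ) : ℂ)).im ≤ 0 := by simpa using hw
    simp only [comp_apply, ofComplex_apply_of_im_nonpos hw, ofComplex_apply_of_im_nonpos h1]

lemma exists_hasQ {f : ℍ → ℂ} (hper : ∀ z, f ((2 : ℝ) +ᵥ z) = f z) (hf : MDiff f)
    (hb : IsBoundedAtImInfty f) : ∃ P, HasQ f P := by
  refine ⟨qExpansion 2 f, fun z => ?_⟩
  simpa [SumsTo] using hasSum_qExpansion two_pos (periodic_comp_ofComplex_of_vadd hper) hf hb z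

/-- A holomorphic quotient that is bounded at `i∞` has the quotient of the expansions as its
expansion. -/
lemma HasQ.div {f g : ℍ → ℂ} {G R : PowerSeries ℂ} (hf : HasQ f (G * R)) (hg : HasQ g G)
    (hg0 : ∀ z, g z ≠ 0) (hd : MDiff (f / g)) (hb : IsBoundedAtImInfty (f / g)) :
    HasQ (f / g) R := by
  obtain ⟨Q, hQ⟩ := exists_hasQ (fun z => by
    simp only [Pi.div_apply, hf.two_vadd, hg.two_vadd]) hd hb
  have hG : G ≠ 0 := by
    rintro rfl
    refine hg0 I ((hg I).unique ?_)
    simpa using SumsTo.const 0 (Periodic.qParam 2 I)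
  have hfg : g * (f / g) = f := by
    funext z
    simp [mul_div_cancel₀ _ (hg0 z)]
  have := (hfg ▸ hg.mul hQ : HasQ f (G * Q)).unique hf
  rwa [mul_left_cancel₀ hG this] at hQ

/-! ### Modular forms for `Γ(2)` -/

/-- The property of being a holomorphic modular form of weight `k` for `Γ(2)`; holomorphy at the
cusps is expressed by boundedness of all `SL(2, ℤ)`-translates at `i∞`. -/
structure IsGammaTwoForm (k : ℤ) (f : ℍ → ℂ) : Prop where
  holo : MDiff f
  slash_eq : ∀ γ ∈ Gamma 2, f ∣[k] γ = f
  bdd : ∀ γ : SL(2, ℤ), IsBoundedAtImInfty (f ∣[k] γ)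

/-- `Γ(2)` inside `GL(2, ℝ)`. -/
abbrev GammaTwoGL : Subgroup (GL (Fin 2) ℝ) :=
  (Gamma 2).map (Matrix.SpecialLinearGroup.mapGL ℝ)

namespace IsGammaTwoForm

variable {k m : ℤ} {f g : ℍ → ℂ}

/-- The bundled modular form. -/
def toModularForm (hf : IsGammaTwoForm k f) : ModularForm GammaTwoGL k where
  toFun := f
  slash_action_eq' := by
    rintro _ ⟨γ, hγ, rfl⟩
    exact hf.slash_eq γ hγ
  holo' := hf.holo
  bdd_at_cusps' hc := by
    rw [Subgroup.IsArithmetic.isCusp_iff_isCusp_SL2Z] at hc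
    rw [OnePoint.isBoundedAt_iff_forall_SL2Z hc]
    exact fun γ _ => hf.bdd γ

lemma add (hf : IsGammaTwoForm k f) (hg : IsGammaTwoForm k g) : IsGammaTwoForm k (f + g) where
  holo := hf.holo.add hg.holo
  slash_eq γ hγ := by rw [SlashAction.add_slash, hf.slash_eq γ hγ, hg.slash_eq γ hγ]
  bdd γ := by
    rw [SlashAction.add_slash]
    exact (hf.bdd γ).add (hg.bdd γ)

lemma smul (c : ℂ) (hf : IsGammaTwoForm k f) : IsGammaTwoForm k (c • f) where
  holo := hf.holo.const_smul c
  slash_eq γ hγ := by rw [ModularForm.SL_smul_slash, hf.slash_eq γ hγ]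
  bdd γ := by
    rw [ModularForm.SL_smul_slash]
    exact (hf.bdd γ).smul c

lemma sub (hf : IsGammaTwoForm k f) (hg : IsGammaTwoForm k g) : IsGammaTwoForm k (f - g) := by
  have := hf.add (hg.smul (-1))
  rwa [neg_one_smul, ← sub_eq_add_neg] at this

lemma mul (hf : IsGammaTwoForm k f) (hg : IsGammaTwoForm m g) :
    IsGammaTwoForm (k + m) (f * g) where
  holo := hf.holo.mul hg.holo
  slash_eq γ hγ := by rw [ModularForm.mul_slash_SL2, hf.slash_eq γ hγ, hg.slash_eq γ hγ]
  bdd γ := by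
    rw [ModularForm.mul_slash_SL2]
    exact (hf.bdd γ).mul (hg.bdd γ)

lemma one : IsGammaTwoForm 0 1 where
  holo := mdifferentiable_const
  slash_eq γ _ := ModularForm.is_invariant_one γ
  bdd γ := by
    rw [ModularForm.is_invariant_one]
    exact Filter.const_boundedAtFilter _ _

lemma congr (hf : IsGammaTwoForm k f) (h : k = m) : IsGammaTwoForm m f := h ▸ hf

lemma pow (hf : IsGammaTwoForm k f) (n : ℕ) : IsGammaTwoForm (n * k) (f ^ n) := by
  induction n with
  | zero => simpa using one
  | succ n ih =>
    rw [pow_succ]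
    exact (ih.mul hf).congr (by push_cast; ring)

lemma slash (hf : IsGammaTwoForm k f) (γ : SL(2, ℤ)) : IsGammaTwoForm k (f ∣[k] γ) where
  holo := by
    rw [ModularForm.SL_slash]
    exact hf.holo.slash k _
  slash_eq δ hδ := by
    have h : γ * δ * γ⁻¹ ∈ Gamma 2 := (Gamma_normal 2).conj_mem δ hδ γ
    rw [← SlashAction.slash_mul, show γ * δ = γ * δ * γ⁻¹ * γ by group, SlashAction.slash_mul,
      hf.slash_eq _ h]
  bdd δ := by
    rw [← SlashAction.slash_mul]
    exact hf.bdd _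

lemma eq_const (hf : IsGammaTwoForm 0 f) : ∃ c : ℂ, f = fun _ => c :=
  ModularForm.eq_const_of_weight_zero hf.toModularForm

lemma isBounded (hf : IsGammaTwoForm k f) : IsBoundedAtImInfty f := by
  simpa using hf.bdd 1

end IsGammaTwoForm

/-- Reduction modulo 2. -/
abbrev modTwo : SL(2, ℤ) →* SL(2, ZMod 2) :=
  Matrix.SpecialLinearGroup.map (Int.castRingHom (ZMod 2))

/-- A family of functions permuted up to a character of `SL(2, 𝔽₂)` by the generators `S` and `T`
of `SL(2, ℤ)` is permuted in the same way by all of `SL(2, ℤ)`. -/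
lemma slash_family {k : ℤ} (χ : SL(2, ZMod 2) →* ℂ) (f : (Fin 2 → ZMod 2) → ℍ → ℂ)
    (hS : ∀ v, f v ∣[k] S = χ (modTwo S) • f (Matrix.vecMul v (modTwo S).1))
    (hT : ∀ v, f v ∣[k] T = χ (modTwo T) • f (Matrix.vecMul v (modTwo T).1))
    (γ : SL(2, ℤ)) (v : Fin 2 → ZMod 2) :
    f v ∣[k] γ = χ (modTwo γ) • f (Matrix.vecMul v (modTwo γ).1) := by
  have h : γ ∈ Subgroup.closure {S, T} := by simp [SpecialLinearGroup.SL2Z_generators]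
  induction h using Subgroup.closure_induction generalizing v with
  | one => simp
  | mem g hg =>
    rcases hg with rfl | rfl
    · exact hS v
    · exact hT v
  | mul g h _ _ hg hh =>
    rw [SlashAction.slash_mul, hg, ModularForm.SL_smul_slash, hh, smul_smul, ← map_mul, ← map_mul,
      Matrix.vecMul_vecMul, ← Matrix.SpecialLinearGroup.coe_mul, ← map_mul]
  | inv g _ hg =>
    have h1 := hg (Matrix.vecMul v (modTwo g⁻¹).1)
    rw [Matrix.vecMul_vecMul, ← Matrix.SpecialLinearGroup.coe_mul, ← map_mul, inv_mul_cancel,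
      map_one, Matrix.SpecialLinearGroup.coe_one, Matrix.vecMul_one] at h1
    have hχ : χ (modTwo g⁻¹) * χ (modTwo g) = 1 := by
      rw [← map_mul, ← map_mul, inv_mul_cancel, map_one, map_one]
    have h2 : f v = χ (modTwo g⁻¹) • (f (Matrix.vecMul v (modTwo g⁻¹).1) ∣[k] g) := by
      rw [h1, smul_smul, hχ, one_smul]
    conv_lhs => rw [h2]
    rw [ModularForm.SL_smul_slash, ← SlashAction.slash_mul, mul_inv_cancel, SlashAction.slash_one]

lemma exists_gammaTwo_mul (γ : SL(2, ℤ)) :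
    ∃ δ ∈ Gamma 2, ∃ r : SL(2, ℤ), (r = 1 ∨ r = T ∨ r = S ∨ r = S * T ∨ r = T * S ∨
      r = T * S * T) ∧ γ = δ * r := by
  have h : ∀ M : SL(2, ZMod 2), modTwo 1 = M ∨ modTwo T = M ∨ modTwo S = M ∨
      modTwo (S * T) = M ∨ modTwo (T * S) = M ∨ modTwo (T * S * T) = M := by decide
  obtain ⟨r, hr, hM⟩ : ∃ r : SL(2, ℤ), (r = 1 ∨ r = T ∨ r = S ∨ r = S * T ∨ r = T * S ∨
      r = T * S * T) ∧ modTwo r = modTwo γ := by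
    rcases h (modTwo γ) with h | h | h | h | h | h <;> exact ⟨_, by simp, h⟩
  refine ⟨γ * r⁻¹, ?_, r, hr, by group⟩
  change modTwo (γ * r⁻¹) = 1
  rw [map_mul, map_inv, hM, mul_inv_cancel]

lemma bounded_slash_T {k : ℤ} {f : ℍ → ℂ} (hf : IsBoundedAtImInfty f) :
    IsBoundedAtImInfty (f ∣[k] T) := by
  rw [ModularForm.SL_slash]
  exact hf.slash k (by simp [ModularGroup.coe_T])

/-- Boundedness at all cusps need only be checked at the three cusps of `Γ(2)`. -/
lemma bounded_slash_of_cusps {k : ℤ} {f : ℍ → ℂ} (hinv : ∀ γ ∈ Gamma 2, f ∣[k] γ = f)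
    (h1 : IsBoundedAtImInfty f) (hS : IsBoundedAtImInfty (f ∣[k] S))
    (hTS : IsBoundedAtImInfty ((f ∣[k] T) ∣[k] S)) (γ : SL(2, ℤ)) :
    IsBoundedAtImInfty (f ∣[k] γ) := by
  obtain ⟨δ, hδ, r, rfl | rfl | rfl | rfl | rfl | rfl, rfl⟩ := exists_gammaTwo_mul γ
  · rwa [mul_one, hinv δ hδ]
  · rw [SlashAction.slash_mul, hinv δ hδ]
    exact bounded_slash_T h1
  · rwa [SlashAction.slash_mul, hinv δ hδ]
  · rw [SlashAction.slash_mul, hinv δ hδ, SlashAction.slash_mul]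
    exact bounded_slash_T hS
  · rwa [SlashAction.slash_mul, hinv δ hδ, SlashAction.slash_mul]
  · rw [SlashAction.slash_mul, hinv δ hδ, SlashAction.slash_mul, SlashAction.slash_mul]
    exact bounded_slash_T hTS

/-- The sign character of `SL(2, 𝔽₂)`, a symmetric group on three letters: its elements of
order three are those of trace one. -/
def sgnTwo : SL(2, ZMod 2) →* ℂ where
  toFun M := if M = 1 ∨ M 0 0 + M 1 1 = 1 then 1 else -1
  map_one' := by simp
  map_mul' M N := by
    have h : ∀ M N : SL(2, ZMod 2),
        ((if M * N = 1 ∨ (M * N) 0 0 + (M * N) 1 1 = 1 then 1 else -1 : ℤ)) =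
          (if M = 1 ∨ M 0 0 + M 1 1 = 1 then 1 else -1) *
            (if N = 1 ∨ N 0 0 + N 1 1 = 1 then 1 else -1) := by decide
    have := congrArg (Int.cast : ℤ → ℂ) (h M N)
    simpa using this

lemma sgnTwo_S : sgnTwo (modTwo S) = -1 := by
  have h : ¬(modTwo S = 1 ∨ modTwo S 0 0 + modTwo S 1 1 = 1) := by decide
  simp only [sgnTwo, MonoidHom.coe_mk, OneHom.coe_mk]
  rw [if_neg h]

lemma sgnTwo_T : sgnTwo (modTwo T) = -1 := by
  have h : ¬(modTwo T = 1 ∨ modTwo T 0 0 + modTwo T 1 1 = 1) := by decide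
  simp only [sgnTwo, MonoidHom.coe_mk, OneHom.coe_mk]
  rw [if_neg h]

/-- The three functions `g`, `ε g|S`, `g|ST`, indexed by the nonzero row vectors modulo 2. -/
def cuspFamily (k : ℤ) (ε : ℂ) (g : ℍ → ℂ) (v : Fin 2 → ZMod 2) : ℍ → ℂ :=
  if v = ![0, 1] then g else if v = ![1, 0] then ε • (g ∣[k] S) else
    if v = ![1, 1] then (g ∣[k] S) ∣[k] T else 0

lemma slash_S_slash_S {k : ℤ} (hk : Even k) (g : ℍ → ℂ) : (g ∣[k] S) ∣[k] S = g := by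
  rw [← SlashAction.slash_mul]
  ext z
  have h : S * S = -1 := by decide
  rw [h, ModularForm.SL_slash_apply]
  have : UpperHalfPlane.denom ((-1 : SL(2, ℤ)) : GL (Fin 2) ℝ) z = -1 := by
    simp [UpperHalfPlane.denom]
  rw [this, hk.neg.neg_one_zpow, mul_one]
  simp

/-- If `T` acts on `g` by the scalar `ε = ±1` and `T²` fixes `g|S`, then `S` acts on `g|ST`
by `ε`. -/
lemma slash_T_slash_S {k : ℤ} {ε : ℂ} (hε : ε * ε = 1) {g : ℍ → ℂ}
    (hT : g ∣[k] T = ε • g) (hTT : ((g ∣[k] S) ∣[k] T) ∣[k] T = g ∣[k] S) :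
    ((g ∣[k] S) ∣[k] T) ∣[k] S = ε • ((g ∣[k] S) ∣[k] T) := by
  -- the relation `(ST)³ = -1`
  have h : S * (T * (S * T)) = T⁻¹ * S := by decide
  have hT' : g ∣[k] T⁻¹ = ε • g := by
    have := congrArg (fun f => ε • (f ∣[k] T⁻¹)) hT
    simp only [ModularForm.SL_smul_slash, ← SlashAction.slash_mul, mul_inv_cancel,
      SlashAction.slash_one, smul_smul, hε, one_smul] at this
    exact this.symm
  have h1 : (((g ∣[k] S) ∣[k] T) ∣[k] S) ∣[k] T = ε • (g ∣[k] S) := by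
    rw [← SlashAction.slash_mul, ← SlashAction.slash_mul, ← SlashAction.slash_mul, h,
      SlashAction.slash_mul, hT', ModularForm.SL_smul_slash]
  have h2 : ((((g ∣[k] S) ∣[k] T) ∣[k] S) ∣[k] T) ∣[k] T⁻¹ =
      (ε • (g ∣[k] S)) ∣[k] T⁻¹ := by rw [h1]
  rw [← SlashAction.slash_mul _ T T⁻¹, mul_inv_cancel, SlashAction.slash_one] at h2
  rw [h2, ModularForm.SL_smul_slash]
  conv_lhs => rw [← hTT, ← SlashAction.slash_mul _ T T⁻¹, mul_inv_cancel, SlashAction.slash_one]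

lemma cuspFamily_S {k : ℤ} (hk : Even k) {ε : ℂ} (hε : ε * ε = 1) {g : ℍ → ℂ}
    (hT : g ∣[k] T = ε • g) (hTT : ((g ∣[k] S) ∣[k] T) ∣[k] T = g ∣[k] S)
    (v : Fin 2 → ZMod 2) :
    cuspFamily k ε g v ∣[k] S = ε • cuspFamily k ε g (Matrix.vecMul v (modTwo S).1) := by
  have hv : v = ![0, 0] ∨ v = ![0, 1] ∨ v = ![1, 0] ∨ v = ![1, 1] := by
    revert v; decide
  have e0 : Matrix.vecMul ![0, 0] (modTwo S).1 = ![0, 0] := by decide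
  have e1 : Matrix.vecMul ![0, 1] (modTwo S).1 = ![1, 0] := by decide
  have e2 : Matrix.vecMul ![1, 0] (modTwo S).1 = ![0, 1] := by decide
  have e3 : Matrix.vecMul ![1, 1] (modTwo S).1 = ![1, 1] := by decide
  rcases hv with rfl | rfl | rfl | rfl
  · rw [e0]
    simp [cuspFamily]
  · rw [e1]
    simp [cuspFamily, smul_smul, hε]
  · rw [e2]
    simp [cuspFamily, slash_S_slash_S hk]
  · rw [e3]
    simp [cuspFamily, slash_T_slash_S hε hT hTT]

lemma cuspFamily_T {k : ℤ} {ε : ℂ} (hε : ε * ε = 1) {g : ℍ → ℂ}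
    (hT : g ∣[k] T = ε • g) (hTT : ((g ∣[k] S) ∣[k] T) ∣[k] T = g ∣[k] S)
    (v : Fin 2 → ZMod 2) :
    cuspFamily k ε g v ∣[k] T = ε • cuspFamily k ε g (Matrix.vecMul v (modTwo T).1) := by
  have hv : v = ![0, 0] ∨ v = ![0, 1] ∨ v = ![1, 0] ∨ v = ![1, 1] := by
    revert v; decide
  have e0 : Matrix.vecMul ![0, 0] (modTwo T).1 = ![0, 0] := by decide
  have e1 : Matrix.vecMul ![0, 1] (modTwo T).1 = ![0, 1] := by decide
  have e2 : Matrix.vecMul ![1, 0] (modTwo T).1 = ![1, 1] := by decide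
  have e3 : Matrix.vecMul ![1, 1] (modTwo T).1 = ![1, 0] := by decide
  rcases hv with rfl | rfl | rfl | rfl
  · rw [e0]
    simp [cuspFamily]
  · rw [e1]
    simp [cuspFamily, hT]
  · rw [e2]
    simp [cuspFamily]
  · rw [e3]
    simp [cuspFamily, hTT, smul_smul, hε]

/-- A criterion for `Γ(2)`-modularity in terms of the generators `S` and `T` of `SL(2, ℤ)`. -/
lemma isGammaTwoForm_of_S_T {k : ℤ} (hk : Even k) {ε : ℂ} (hε : ε = 1 ∨ ε = -1) {g : ℍ → ℂ}
    (hT : g ∣[k] T = ε • g) (hTT : ((g ∣[k] S) ∣[k] T) ∣[k] T = g ∣[k] S) (hd : MDiff g)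
    (hb : IsBoundedAtImInfty g) (hbS : IsBoundedAtImInfty (g ∣[k] S)) :
    IsGammaTwoForm k g := by
  have hε2 : ε * ε = 1 := by rcases hε with rfl | rfl <;> norm_num
  obtain ⟨χ, hχS, hχT⟩ : ∃ χ : SL(2, ZMod 2) →* ℂ, χ (modTwo S) = ε ∧ χ (modTwo T) = ε := by
    rcases hε with rfl | rfl
    · exact ⟨1, rfl, rfl⟩
    · exact ⟨sgnTwo, sgnTwo_S, sgnTwo_T⟩
  have hinv : ∀ γ ∈ Gamma 2, g ∣[k] γ = g := by
    intro γ hγ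
    have h := slash_family χ (cuspFamily k ε g) (fun v => by
      rw [hχS]
      exact cuspFamily_S hk hε2 hT hTT v)
      (fun v => by rw [hχT]; exact cuspFamily_T hε2 hT hTT v) γ ![0, 1]
    have h1 : modTwo γ = 1 := hγ
    simpa [h1, cuspFamily] using h
  refine ⟨hd, hinv, bounded_slash_of_cusps hinv hb hbS ?_⟩
  rw [hT, ModularForm.SL_smul_slash]
  exact hbS.smul ε

/-! ### Upper triangular matrices -/

/-- The matrix `(a, b; 0, d)` with `a, d > 0`. -/
def upperTri (a b d : ℝ) (ha : 0 < a) (hd : 0 < d) : GL (Fin 2) ℝ :=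
  Matrix.GeneralLinearGroup.mkOfDetNeZero !![a, b; 0, d] (by
    simp [Matrix.det_fin_two, ha.ne', hd.ne'])

/-- The point `(az + b)/d` of the upper half plane. -/
def affinePt (a b d : ℝ) (ha : 0 < a) (hd : 0 < d) (z : ℍ) : ℍ :=
  ⟨(a * z + b) / d, by
    have : ((a * z + b) / d : ℂ).im = a * z.im / d := by
      rw [Complex.div_ofReal_im]
      simp
    rw [this]
    have := z.im_pos
    positivity⟩

lemma upperTri_smul (a b d : ℝ) (ha : 0 < a) (hd : 0 < d) (z : ℍ) :
    upperTri a b d ha hd • z = affinePt a b d ha hd z := by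
  have hdet : 0 < (upperTri a b d ha hd).det.val := by
    simp [upperTri, Matrix.det_fin_two, ha, hd]
  ext
  rw [UpperHalfPlane.coe_smul_of_det_pos hdet]
  simp [upperTri, affinePt, UpperHalfPlane.num, UpperHalfPlane.denom,
    Matrix.GeneralLinearGroup.mkOfDetNeZero]

lemma slash_upperTri (k : ℤ) (f : ℍ → ℂ) (a b d : ℝ) (ha : 0 < a) (hd : 0 < d) (z : ℍ) :
    (f ∣[k] upperTri a b d ha hd) z
      = (a : ℂ) ^ (k - 1) * (d : ℂ)⁻¹ * f (affinePt a b d ha hd z) := by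
  have hdet : (upperTri a b d ha hd).det.val = a * d := by
    simp [upperTri, Matrix.det_fin_two]
  have hden : UpperHalfPlane.denom (upperTri a b d ha hd) z = d := by
    simp [upperTri, UpperHalfPlane.denom, Matrix.GeneralLinearGroup.mkOfDetNeZero]
  have hpos : 0 < a * d := mul_pos ha hd
  have hd' : (d : ℂ) ≠ 0 := by exact_mod_cast hd.ne'
  rw [ModularForm.slash_apply, hdet, hden, upperTri_smul, abs_of_pos hpos]
  have hσ : UpperHalfPlane.σ (upperTri a b d ha hd) = .refl ℝ ℂ := by
    simp [UpperHalfPlane.σ, hdet, hpos]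
  rw [hσ]
  push_cast
  rw [mul_zpow, show (-k : ℤ) = -(k - 1) + -1 by ring, zpow_add₀ hd', zpow_neg _ (k - 1),
    zpow_neg_one]
  have : (d : ℂ) ^ (k - 1) ≠ 0 := zpow_ne_zero _ hd'
  simp only [ContinuousAlgEquiv.refl_apply]
  field_simp

lemma slash_T_apply (k : ℤ) (f : ℍ → ℂ) (z : ℍ) : (f ∣[k] T) z = f ((1 : ℝ) +ᵥ z) := by
  rw [ModularForm.SL_slash_apply, modular_T_smul]
  simp [UpperHalfPlane.denom, ModularGroup.coe_T]

lemma slash_T_T_apply (k : ℤ) (f : ℍ → ℂ) (z : ℍ) :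
    ((f ∣[k] T) ∣[k] T) z = f ((2 : ℝ) +ᵥ z) := by
  rw [slash_T_apply, slash_T_apply, vadd_vadd]
  norm_num

lemma slash_S_apply (k : ℤ) (f : ℍ → ℂ) (z : ℍ) :
    (f ∣[k] S) z = f (S • z) * (z : ℂ) ^ (-k) := by
  rw [ModularForm.SL_slash_apply, ModularGroup.denom_S]

lemma coe_S_smul (z : ℍ) : ((S • z : ℍ) : ℂ) = -1 / z := by
  rw [modular_S_smul]
  simp [neg_div]

/-! ### Eta quotients -/

lemma qParam_one_add_one (z : ℂ) : Periodic.qParam 1 (z + 1) = Periodic.qParam 1 z := by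
  have : 2 * Real.pi * Complex.I * (z + 1) / (1 : ℝ)
      = 2 * Real.pi * Complex.I * z / (1 : ℝ) + 2 * Real.pi * Complex.I := by
    push_cast; ring
  rw [Periodic.qParam, Periodic.qParam, this, Complex.exp_add, Complex.exp_two_pi_mul_I, mul_one]

lemma eta_add_one (z : ℂ) :
    eta (z + 1) = Complex.exp (Real.pi * Complex.I / 12) * eta z := by
  have h24 : Periodic.qParam 24 (z + 1)
      = Complex.exp (Real.pi * Complex.I / 12) * Periodic.qParam 24 z := by
    rw [Periodic.qParam, Periodic.qParam, ← Complex.exp_add]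
    congr 1
    push_cast
    ring
  simp only [eta, ModularForm.eta_q, qParam_one_add_one, h24, mul_assoc]

lemma exp_pi_div_twelve_pow : Complex.exp (Real.pi * Complex.I / 12) ^ 12 = -1 := by
  rw [← Complex.exp_nat_mul]
  have : ((12 : ℕ) : ℂ) * (Real.pi * Complex.I / 12) = Real.pi * Complex.I := by
    push_cast; ring
  rw [this, Complex.exp_pi_mul_I]

/-- The square of the transformation law of `η`, which is free of square roots. -/
lemma eta_neg_one_div_sq {w : ℂ} (hw : 0 < w.im) :
    eta (-1 / w) ^ 2 = -Complex.I * w * eta w ^ 2 := by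
  have h := ModularForm.eta_comp_eq_csqrt_I_inv (show w ∈ upperHalfPlaneSet from hw)
  have h' : eta (-1 / w) = (Complex.sqrt Complex.I)⁻¹ * (Complex.sqrt w * eta w) := by
    simpa using h
  have hs : ∀ x : ℂ, x ≠ 0 → Complex.sqrt x ^ 2 = x := fun x hx => by
    rw [_root_.sqrt_eq_exp hx, ← Complex.exp_nat_mul]
    convert Complex.exp_log hx using 2
    push_cast
    ring
  have hw0 : w ≠ 0 := by
    rintro rfl
    simp at hw
  rw [h', mul_pow, mul_pow, inv_pow, hs _ Complex.I_ne_zero, hs _ hw0, Complex.inv_I]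
  ring

/-- Division of expansions when the denominator does not vanish at `i∞`. -/
lemma HasQ.div_of_coeff_ne_zero {f g : ℍ → ℂ} {G R : PowerSeries ℂ} (hf : HasQ f (G * R))
    (hg : HasQ g G) (hG : coeff 0 G ≠ 0) (hg0 : ∀ z, g z ≠ 0) (hd : MDiff (f / g)) :
    HasQ (f / g) R :=
  hf.div hg hg0 hd ((hf.tendsto.div hg.tendsto hG).isBigO_one (F := ℝ))

/-- The Euler function `∏ (1 - qⁿ)` as an integral power series. -/
abbrev eulerSeries : PowerSeries ℤ := pentagonalSeries ℤ

lemma coeff_zero_eulerSeries : coeff 0 eulerSeries = 1 := by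
  exact (coeff_pentagonalSeries_pentagonal ℤ 0).trans (by simp)

lemma coeff_one_eulerSeries : coeff 1 eulerSeries = -1 := by
  exact (coeff_pentagonalSeries_pentagonal ℤ 1).trans (by simp)

/-- The function `∏ (1 - wⁿ)`. -/
def eulerFun (w : ℂ) : ℂ := ∏' n : ℕ, (1 - w ^ (n + 1))

lemma eta_eq (z : ℂ) :
    eta z = Periodic.qParam 24 z * eulerFun (Periodic.qParam 1 z) := rfl

lemma qParam_pow (h : ℝ) (n : ℕ) (z : ℂ) :
    Periodic.qParam h z ^ n = Periodic.qParam h (n * z) := by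
  rw [Periodic.qParam, Periodic.qParam, ← Complex.exp_nat_mul]
  congr 1
  ring

lemma qParam_mul_right {c : ℝ} (hc : c ≠ 0) (h : ℝ) (z : ℂ) :
    Periodic.qParam (c * h) (c * z) = Periodic.qParam h z := by
  rw [Periodic.qParam, Periodic.qParam]
  congr 1
  have : (c : ℂ) ≠ 0 := by exact_mod_cast hc
  push_cast
  rw [show 2 * (Real.pi : ℂ) * Complex.I * (c * z) = c * (2 * Real.pi * Complex.I * z) by ring,
    mul_div_mul_left _ _ this]

/-- The function `∏ (1 - q^{kn})` on the upper half plane, `q = exp(π i z)`. -/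
def eulerK (k : ℕ) (z : ℍ) : ℂ := eulerFun (Periodic.qParam 2 z ^ k)

lemma hasQ_eulerK {k : ℕ} (hk : k ≠ 0) :
    HasQ (eulerK k) (toC (PowerSeries.expand k hk eulerSeries)) := fun z => by
  have h := sumsTo_pentagonalSeries (q := Periodic.qParam 2 z ^ k) (by
    rw [norm_pow]
    exact pow_lt_one₀ (norm_nonneg _) (norm_qParam_two_lt_one z) hk)
  have := h.expand hk
  rwa [show toC (PowerSeries.expand k hk eulerSeries) = PowerSeries.expand k hk (toC eulerSeries)
    from (PowerSeries.map_expand ..)]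

lemma eta_eq_eulerK (z : ℍ) : eta z = Periodic.qParam 24 z * eulerK 2 z := by
  rw [eta_eq, eulerK, qParam_pow]
  have := qParam_mul_right two_ne_zero 1 z
  push_cast at this ⊢
  rw [← this]
  norm_num

lemma eta_two_mul_eq_eulerK (z : ℍ) :
    eta (2 * z) = Periodic.qParam 24 z ^ 2 * eulerK 4 z := by
  rw [eta_eq, eulerK, qParam_pow, qParam_pow]
  have := qParam_mul_right two_ne_zero 1 (2 * z)
  push_cast at this ⊢
  rw [← this]
  norm_num
  left
  ring_nf

lemma eta_half_pow_two_eq_eulerK (z : ℍ) :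
    eta (z / 2) ^ 2 = Periodic.qParam 24 z * eulerK 1 z ^ 2 := by
  rw [eta_eq, eulerK, pow_one, mul_pow, qParam_pow]
  have := qParam_mul_right two_ne_zero 1 ((z : ℂ) / 2)
  push_cast at this ⊢
  rw [mul_div_cancel₀ _ (two_ne_zero), mul_one] at this
  rw [← this, mul_div_cancel₀ _ (two_ne_zero)]

lemma qParam_pow_twelve (z : ℂ) : Periodic.qParam 24 z ^ 12 = Periodic.qParam 2 z := by
  rw [qParam_pow]
  have := qParam_mul_right (c := 12) (by norm_num) 2 z
  push_cast at this ⊢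
  rw [← this]
  norm_num

lemma eta_coe_ne_zero (z : ℍ) : eta z ≠ 0 := ModularForm.eta_ne_zero z.im_pos

lemma eulerK_two_ne_zero (z : ℍ) : eulerK 2 z ≠ 0 := fun h => by
  have := eta_eq_eulerK z
  rw [h, mul_zero] at this
  exact eta_coe_ne_zero z this

lemma mdifferentiable_of_eta {f : ℍ → ℂ} {g : ℂ → ℂ} (hfg : ∀ z : ℍ, f z = g z)
    (hg : ∀ z : ℂ, 0 < z.im → DifferentiableAt ℂ g z) : MDiff f := by
  rw [UpperHalfPlane.mdifferentiable_iff]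
  refine DifferentiableOn.congr (fun z hz => (hg z hz).differentiableWithinAt) fun z hz => ?_
  simp [hfg, ofComplex_apply_of_im_pos hz]

lemma differentiableAt_eta {z : ℂ} (hz : 0 < z.im) : DifferentiableAt ℂ eta z :=
  ModularForm.differentiableAt_eta_of_mem_upperHalfPlaneSet hz

lemma differentiableAt_eta_two {z : ℂ} (hz : 0 < z.im) :
    DifferentiableAt ℂ (fun z => eta (2 * z)) z :=
  DifferentiableAt.comp (g := eta) (f := fun z : ℂ => 2 * z) z
    (differentiableAt_eta (by simpa using hz)) (by fun_prop)

lemma differentiableAt_eta_half {z : ℂ} (hz : 0 < z.im) :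
    DifferentiableAt ℂ (fun z => eta (z / 2)) z :=
  DifferentiableAt.comp (g := eta) (f := fun z : ℂ => z / 2) z
    (differentiableAt_eta (by simpa using hz)) (by fun_prop)

/-- The form `η(2z)⁸ / η(z)⁴` of weight two for `Γ(2)`, whose value at `2z` is `F(z)`. -/
def alpha (z : ℍ) : ℂ := eta (2 * z) ^ 8 / eta z ^ 4

/-- The form `η(z/2)⁸ / η(z)⁴`, a multiple of the transform of `alpha` under `z ↦ -1/z`. -/
def beta (z : ℍ) : ℂ := eta (z / 2) ^ 8 / eta z ^ 4

/-- The form `η(z)¹²` of weight six for `Γ(2)`, whose value at `2z` is `D₂(z)`. -/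
def delta (z : ℍ) : ℂ := eta z ^ 12

/-- The inverse of `∏ (1 - qⁿ)⁴`. -/
def eulerInv : PowerSeries ℤ := PowerSeries.invOfUnit (eulerSeries ^ 4) 1

/-- The series `∏ (1 - q^{2n})⁸ / (1 - qⁿ)⁴`. -/
def alphaUnit : PowerSeries ℤ := (PowerSeries.expand 2 two_ne_zero eulerSeries) ^ 8 * eulerInv

/-- The expansion of `alpha` in powers of `exp(π i z)`. -/
def alphaSeries : PowerSeries ℤ := PowerSeries.X * PowerSeries.expand 2 two_ne_zero alphaUnit

/-- The expansion of `beta` in powers of `exp(π i z)`. -/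
def betaSeries : PowerSeries ℤ :=
  eulerSeries ^ 8 * PowerSeries.expand 2 two_ne_zero eulerInv

/-- The expansion of `delta` in powers of `exp(π i z)`. -/
def deltaSeries : PowerSeries ℤ :=
  PowerSeries.X * (PowerSeries.expand 2 two_ne_zero eulerSeries) ^ 12

lemma eulerSeries_mul_eulerInv : eulerSeries ^ 4 * eulerInv = 1 :=
  PowerSeries.mul_invOfUnit _ _ (by
    rw [map_pow, ← coeff_zero_eq_constantCoeff_apply, coeff_zero_eulerSeries]
    rfl)

lemma expand_eulerSeries_mul_expand_eulerInv :
    (PowerSeries.expand 2 two_ne_zero eulerSeries) ^ 4 *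
      PowerSeries.expand 2 two_ne_zero eulerInv = 1 := by
  rw [← map_pow, ← map_mul, eulerSeries_mul_eulerInv, map_one]

lemma mdiff_alpha : MDiff alpha := by
  refine mdifferentiable_of_eta (g := fun z => eta (2 * z) ^ 8 / eta z ^ 4) (fun _ => rfl)
    fun z hz => ?_
  exact ((differentiableAt_eta_two hz).pow 8).div ((differentiableAt_eta hz).pow 4)
    (pow_ne_zero _ (eta_coe_ne_zero ⟨z, hz⟩))

lemma mdiff_beta : MDiff beta := by
  refine mdifferentiable_of_eta (g := fun z => eta (z / 2) ^ 8 / eta z ^ 4) (fun _ => rfl)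
    fun z hz => ?_
  exact ((differentiableAt_eta_half hz).pow 8).div ((differentiableAt_eta hz).pow 4)
    (pow_ne_zero _ (eta_coe_ne_zero ⟨z, hz⟩))

lemma mdiff_delta : MDiff delta :=
  mdifferentiable_of_eta (g := fun z => eta z ^ 12) (fun _ => rfl)
    fun _ hz => (differentiableAt_eta hz).pow 12

lemma hasQ_qParam : HasQ (fun z => Periodic.qParam 2 z) PowerSeries.X := fun _ => SumsTo.X _

lemma coeff_zero_toC_expand_ne_zero : coeff 0 (toC ((PowerSeries.expand 2 two_ne_zero
    eulerSeries) ^ 4)) ≠ 0 := by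
  have : constantCoeff eulerSeries = 1 := by simpa using coeff_zero_eulerSeries
  rw [PowerSeries.coeff_map, coeff_zero_eq_constantCoeff, map_pow, constantCoeff_expand, this]
  simp

lemma hasQ_alpha : HasQ alpha (toC alphaSeries) := by
  have hg : HasQ (eulerK 2 ^ 4) (toC ((PowerSeries.expand 2 two_ne_zero eulerSeries) ^ 4)) := by
    rw [map_pow]
    exact (hasQ_eulerK _).pow 4
  have hf : HasQ ((fun z : ℍ => Periodic.qParam 2 z) * eulerK 4 ^ 8)
      (toC ((PowerSeries.expand 2 two_ne_zero eulerSeries) ^ 4) * toC alphaSeries) := by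
    have : (PowerSeries.expand 2 two_ne_zero eulerSeries) ^ 4 * alphaSeries =
        PowerSeries.X * (PowerSeries.expand 4 (by norm_num) eulerSeries) ^ 8 := by
      have h4 : PowerSeries.expand 4 (by norm_num) eulerSeries =
          PowerSeries.expand 2 two_ne_zero (PowerSeries.expand 2 two_ne_zero eulerSeries) :=
        PowerSeries.expand_mul (p := 2) (q := 2) ..
      rw [alphaSeries, alphaUnit, map_mul, map_pow, h4]
      linear_combination (PowerSeries.X * (PowerSeries.expand 2 two_ne_zero
        (PowerSeries.expand 2 two_ne_zero eulerSeries)) ^ 8) *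
        expand_eulerSeries_mul_expand_eulerInv
    rw [← map_mul, this, map_mul, map_pow, PowerSeries.map_X]
    exact hasQ_qParam.mul ((hasQ_eulerK _).pow 8)
  have h : alpha = ((fun z : ℍ => Periodic.qParam 2 z) * eulerK 4 ^ 8) / (eulerK 2 ^ 4) := by
    funext z
    have h1 : Periodic.qParam 24 (z : ℂ) ≠ 0 := Periodic.qParam_ne_zero _
    have h2 := eulerK_two_ne_zero z
    simp only [alpha, Pi.div_apply, Pi.mul_apply, Pi.pow_apply, eta_eq_eulerK,
      eta_two_mul_eq_eulerK, ← qParam_pow_twelve]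
    field_simp
  rw [h]
  refine hf.div_of_coeff_ne_zero hg coeff_zero_toC_expand_ne_zero
    (fun z => pow_ne_zero _ (eulerK_two_ne_zero z)) (h ▸ mdiff_alpha)

lemma hasQ_beta : HasQ beta (toC betaSeries) := by
  have hg : HasQ (eulerK 2 ^ 4) (toC ((PowerSeries.expand 2 two_ne_zero eulerSeries) ^ 4)) := by
    rw [map_pow]
    exact (hasQ_eulerK _).pow 4
  have hf : HasQ (eulerK 1 ^ 8)
      (toC ((PowerSeries.expand 2 two_ne_zero eulerSeries) ^ 4) * toC betaSeries) := by
    have : (PowerSeries.expand 2 two_ne_zero eulerSeries) ^ 4 * betaSeries =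
        (PowerSeries.expand 1 (by norm_num) eulerSeries) ^ 8 := by
      rw [betaSeries, PowerSeries.expand_one_apply]
      linear_combination (eulerSeries ^ 8) * expand_eulerSeries_mul_expand_eulerInv
    rw [← map_mul, this, map_pow]
    exact (hasQ_eulerK _).pow 8
  have h : beta = (eulerK 1 ^ 8) / (eulerK 2 ^ 4) := by
    funext z
    have h1 : Periodic.qParam 24 (z : ℂ) ≠ 0 := Periodic.qParam_ne_zero _
    have h2 := eulerK_two_ne_zero z
    have h3 := eta_half_pow_two_eq_eulerK z
    simp only [beta, Pi.div_apply, Pi.pow_apply, eta_eq_eulerK]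
    rw [show eta ((z : ℂ) / 2) ^ 8 = (eta ((z : ℂ) / 2) ^ 2) ^ 4 by ring, h3]
    field_simp
  rw [h]
  refine hf.div_of_coeff_ne_zero hg coeff_zero_toC_expand_ne_zero
    (fun z => pow_ne_zero _ (eulerK_two_ne_zero z)) (h ▸ mdiff_beta)

lemma hasQ_delta : HasQ delta (toC deltaSeries) := by
  have h : delta = (fun z : ℍ => Periodic.qParam 2 z) * eulerK 2 ^ 12 := by
    funext z
    simp only [delta, Pi.mul_apply, Pi.pow_apply, eta_eq_eulerK, ← qParam_pow_twelve]
    ring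
  rw [h, deltaSeries, map_mul, map_pow, PowerSeries.map_X]
  exact hasQ_qParam.mul ((hasQ_eulerK _).pow 12)

lemma alpha_slash_T : alpha ∣[(2 : ℤ)] T = (-1 : ℂ) • alpha := by
  funext z
  have h2 : eta (2 * ((1 : ℂ) + z)) = Complex.exp (Real.pi * Complex.I / 12) ^ 2 * eta (2 * z) := by
    rw [show 2 * ((1 : ℂ) + z) = 2 * z + 1 + 1 by ring, eta_add_one, eta_add_one]
    ring
  have h1 : eta ((1 : ℂ) + z) = Complex.exp (Real.pi * Complex.I / 12) * eta z := by
    rw [add_comm, eta_add_one]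
  have hz := eta_coe_ne_zero z
  rw [slash_T_apply, alpha, UpperHalfPlane.coe_vadd, Pi.smul_apply, alpha, Complex.ofReal_one, h2,
    h1, smul_eq_mul, mul_pow, mul_pow, ← pow_mul, ← exp_pi_div_twelve_pow]
  have := Complex.exp_ne_zero (Real.pi * Complex.I / 12)
  field_simp
  ring

lemma delta_slash_T : delta ∣[(6 : ℤ)] T = (-1 : ℂ) • delta := by
  funext z
  rw [slash_T_apply, delta, UpperHalfPlane.coe_vadd, Complex.ofReal_one, add_comm, eta_add_one,
    mul_pow, exp_pi_div_twelve_pow]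
  rfl

lemma delta_slash_S : delta ∣[(6 : ℤ)] S = (-1 : ℂ) • delta := by
  funext z
  rw [slash_S_apply, delta, coe_S_smul,
    show eta (-1 / (z : ℂ)) ^ 12 = (eta (-1 / (z : ℂ)) ^ 2) ^ 6 by ring,
    eta_neg_one_div_sq z.im_pos, Pi.smul_apply, delta, smul_eq_mul]
  have hz := UpperHalfPlane.ne_zero z
  rw [show (-(6 : ℤ)) = -((6 : ℕ) : ℤ) by norm_num, zpow_neg, zpow_natCast]
  have hI : (-Complex.I) ^ 6 = -1 := by
    rw [show (-Complex.I) ^ 6 = (Complex.I ^ 2) ^ 3 by ring, Complex.I_sq]; norm_num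
  rw [mul_pow, mul_pow, hI]
  field_simp

lemma alpha_slash_S : alpha ∣[(2 : ℤ)] S = (-1 / 16 : ℂ) • beta := by
  funext z
  have hz := UpperHalfPlane.ne_zero z
  have h1 : eta (2 * (-1 / (z : ℂ))) ^ 2 = -Complex.I * (z / 2) * eta (z / 2) ^ 2 := by
    rw [← eta_neg_one_div_sq (by simpa using z.im_pos)]
    congr 2
    field_simp
  have h2 := eta_neg_one_div_sq z.im_pos
  have he := eta_coe_ne_zero z
  have hI4 := Complex.I_pow_four
  have hI2 := Complex.I_sq
  rw [slash_S_apply, alpha, coe_S_smul,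
    show eta (2 * (-1 / (z : ℂ))) ^ 8 = (eta (2 * (-1 / (z : ℂ))) ^ 2) ^ 4 by ring,
    show eta (-1 / (z : ℂ)) ^ 4 = (eta (-1 / (z : ℂ)) ^ 2) ^ 2 by ring, h1, h2, Pi.smul_apply,
    beta, smul_eq_mul]
  rw [show (-(2 : ℤ)) = -((2 : ℕ) : ℤ) by norm_num, zpow_neg, zpow_natCast]
  have e1 : (-Complex.I * (z / 2) * eta ((z : ℂ) / 2) ^ 2) ^ 4
      = z ^ 4 / 16 * eta ((z : ℂ) / 2) ^ 8 := by
    linear_combination (z : ℂ) ^ 4 / 16 * eta ((z : ℂ) / 2) ^ 8 * hI4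
  have e2 : (-Complex.I * z * eta (z : ℂ) ^ 2) ^ 2 = - (z ^ 2 * eta (z : ℂ) ^ 4) := by
    linear_combination (z : ℂ) ^ 2 * eta (z : ℂ) ^ 4 * hI2
  rw [e1, e2]
  field_simp

lemma beta_slash_T_T : (beta ∣[(2 : ℤ)] T) ∣[(2 : ℤ)] T = beta := by
  funext z
  rw [slash_T_T_apply, hasQ_beta.two_vadd]

lemma isGammaTwoForm_alpha : IsGammaTwoForm 2 alpha := by
  refine isGammaTwoForm_of_S_T (by decide) (Or.inr rfl) alpha_slash_T ?_ mdiff_alpha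
    hasQ_alpha.isBounded ?_
  · rw [alpha_slash_S, ModularForm.SL_smul_slash, ModularForm.SL_smul_slash, beta_slash_T_T]
  · rw [alpha_slash_S]
    exact hasQ_beta.isBounded.smul _

lemma isGammaTwoForm_delta : IsGammaTwoForm 6 delta := by
  refine isGammaTwoForm_of_S_T (by decide) (Or.inr rfl) delta_slash_T ?_ mdiff_delta
    hasQ_delta.isBounded ?_
  · rw [delta_slash_S]
    simp only [ModularForm.SL_smul_slash, delta_slash_T, smul_smul]
    norm_num
  · rw [delta_slash_S]
    exact hasQ_delta.isBounded.smul _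

lemma beta_eq : beta = (-16 : ℂ) • (alpha ∣[(2 : ℤ)] S) := by
  rw [alpha_slash_S, smul_smul]
  norm_num

lemma isGammaTwoForm_beta : IsGammaTwoForm 2 beta := by
  rw [beta_eq]
  exact (isGammaTwoForm_alpha.slash S).smul _

lemma coeff_zero_eulerInv : coeff 0 eulerInv = 1 := by
  have h := congrArg (coeff 0) eulerSeries_mul_eulerInv
  have h0 : constantCoeff eulerSeries = 1 := by simpa using coeff_zero_eulerSeries
  rw [coeff_zero_eq_constantCoeff, map_mul, map_pow, h0, map_one, one_pow, one_mul] at h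
  rwa [coeff_zero_eq_constantCoeff]

lemma coeff_zero_alphaUnit : coeff 0 alphaUnit = 1 := by
  have h : constantCoeff eulerSeries = 1 := by simpa using coeff_zero_eulerSeries
  have h2 : constantCoeff eulerInv = 1 := by simpa using coeff_zero_eulerInv
  rw [coeff_zero_eq_constantCoeff, alphaUnit, map_mul, map_pow, constantCoeff_expand, h, h2]
  norm_num

lemma coeff_one_eulerInv : coeff 1 eulerInv = 4 := by
  have h0 : constantCoeff eulerSeries = 1 := by simpa using coeff_zero_eulerSeries
  have h2 : constantCoeff eulerInv = 1 := by simpa using coeff_zero_eulerInv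
  have h := congrArg (coeff 1) eulerSeries_mul_eulerInv
  rw [coeff_one_mul, coeff_one_pow, map_pow, h0, h2, coeff_one_eulerSeries, coeff_one] at h
  norm_num at h
  linarith

lemma coeff_one_alphaUnit : coeff 1 alphaUnit = 4 := by
  have h0 : constantCoeff eulerSeries = 1 := by simpa using coeff_zero_eulerSeries
  have h1 : coeff 1 (PowerSeries.expand 2 two_ne_zero eulerSeries) = 0 :=
    coeff_expand_of_not_dvd _ _ _ (by norm_num)
  have h2 : constantCoeff eulerInv = 1 := by simpa using coeff_zero_eulerInv
  rw [alphaUnit, coeff_one_mul, coeff_one_pow, map_pow, constantCoeff_expand, h0, h1,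
    coeff_one_eulerInv]
  norm_num

lemma coeff_zero_betaSeries : coeff 0 betaSeries = 1 := by
  have h0 : constantCoeff eulerSeries = 1 := by simpa using coeff_zero_eulerSeries
  have h2 : constantCoeff eulerInv = 1 := by simpa using coeff_zero_eulerInv
  rw [coeff_zero_eq_constantCoeff, betaSeries, map_mul, map_pow, constantCoeff_expand, h0, h2]
  norm_num

lemma coeff_one_betaSeries : coeff 1 betaSeries = -8 := by
  have h0 : constantCoeff eulerSeries = 1 := by simpa using coeff_zero_eulerSeries
  have h1 : coeff 1 (PowerSeries.expand 2 two_ne_zero eulerInv) = 0 :=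
    coeff_expand_of_not_dvd _ _ _ (by norm_num)
  have h2 : constantCoeff eulerInv = 1 := by simpa using coeff_zero_eulerInv
  rw [betaSeries, coeff_one_mul, coeff_one_pow, map_pow, constantCoeff_expand, h0, h1, h2,
    coeff_one_eulerSeries]
  norm_num

/-! ### The Eisenstein series of weight two -/

/-- The expansion of `E₂` in powers of `exp(2π i z)`. -/
def e2Series : PowerSeries ℤ :=
  PowerSeries.mk fun m => if m = 0 then 1 else -24 * (ArithmeticFunction.sigma 1 m : ℤ)

lemma sumsTo_e2Series (z : ℍ) : SumsTo (toC e2Series) (Periodic.qParam 1 z) (E2 z) := by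
  refine SumsTo.of_hasSum (EisensteinSeries.hasSum_qExpansion_E2 (z := z)) fun n => ?_
  rw [PowerSeries.coeff_map, e2Series, PowerSeries.coeff_mk]
  split_ifs <;> simp [Periodic.qParam]

/-- The point `2z`. -/
def dbl (z : ℍ) : ℍ := ⟨2 * z, by simpa using z.im_pos⟩

/-- The point `z/2`. -/
def half (z : ℍ) : ℍ := ⟨z / 2, by simpa using z.im_pos⟩

/-- The Eisenstein series `2E₂(2z) - E₂(z)` of weight two. -/
def eis (z : ℍ) : ℂ := 2 * E2 (dbl z) - E2 z

/-- The expansion of `eis` in powers of `exp(π i z)`. -/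
def eisSeries : PowerSeries ℤ :=
  2 * PowerSeries.expand 4 (by norm_num) e2Series - PowerSeries.expand 2 (by norm_num) e2Series

lemma hasQ_E2 : HasQ E2 (toC (PowerSeries.expand 2 (by norm_num) e2Series)) := fun z => by
  rw [show toC (PowerSeries.expand 2 (by norm_num) e2Series) = PowerSeries.expand 2 (by norm_num)
    (toC e2Series) from (PowerSeries.map_expand ..)]
  refine SumsTo.expand _ ?_
  convert sumsTo_e2Series z using 1
  rw [qParam_pow]
  simpa using qParam_mul_right two_ne_zero 1 z

lemma hasQ_E2_dbl :
    HasQ (fun z => E2 (dbl z)) (toC (PowerSeries.expand 4 (by norm_num) e2Series)) := fun z => by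
  rw [show toC (PowerSeries.expand 4 (by norm_num) e2Series) = PowerSeries.expand 4 (by norm_num)
    (toC e2Series) from (PowerSeries.map_expand ..)]
  refine SumsTo.expand _ ?_
  convert sumsTo_e2Series (dbl z) using 1
  rw [qParam_pow]
  have := qParam_mul_right two_ne_zero 1 (2 * z)
  simp only [dbl, UpperHalfPlane.coe_mk]
  rw [← this]
  push_cast
  ring_nf

lemma hasQ_E2_half : HasQ (fun z => E2 (half z)) (toC e2Series) := fun z => by
  convert sumsTo_e2Series (half z) using 1
  have := qParam_mul_right two_ne_zero 1 ((z : ℂ) / 2)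
  simp only [half, UpperHalfPlane.coe_mk]
  rw [← this]
  push_cast
  ring_nf

lemma hasQ_eis : HasQ eis (toC eisSeries) := by
  have h := (hasQ_E2_dbl.smul 2).sub hasQ_E2
  have h1 : toC eisSeries = C 2 * toC (PowerSeries.expand 4 (by norm_num) e2Series) -
      toC (PowerSeries.expand 2 (by norm_num) e2Series) := by
    rw [eisSeries, map_sub, map_mul, map_ofNat, map_ofNat]
  rw [h1]
  exact h

lemma eis_slash_T : eis ∣[(2 : ℤ)] T = (1 : ℂ) • eis := by
  funext z
  have hT : ∀ z : ℍ, E2 ((1 : ℝ) +ᵥ z) = E2 z := fun z => by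
    refine (sumsTo_e2Series _).unique ?_
    convert sumsTo_e2Series z using 1
    rw [UpperHalfPlane.coe_vadd, add_comm, Complex.ofReal_one, qParam_one_add_one]
  have h2 : dbl ((1 : ℝ) +ᵥ z) = (1 : ℝ) +ᵥ ((1 : ℝ) +ᵥ dbl z) := by
    ext
    simp only [dbl, UpperHalfPlane.coe_mk, UpperHalfPlane.coe_vadd]
    push_cast
    ring
  rw [slash_T_apply, eis, h2, hT, hT, hT, one_smul]
  rfl

/-- The transformation of `E₂` under `z ↦ -1/z`; the value of the constant plays no role. -/
lemma exists_E2_S_smul : ∃ c : ℂ, ∀ z : ℍ, E2 (S • z) = z ^ 2 * (E2 z - c / z) := by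
  refine ⟨1 / (2 * riemannZeta 2) * (2 * Real.pi * Complex.I), fun z => ?_⟩
  have h := congrFun (EisensteinSeries.E2_slash_action S) z
  have hz := UpperHalfPlane.ne_zero z
  rw [slash_S_apply, Pi.sub_apply, Pi.smul_apply, EisensteinSeries.D2_S,
    show (-(2 : ℤ)) = -((2 : ℕ) : ℤ) by norm_num, zpow_neg, zpow_natCast, smul_eq_mul] at h
  rw [mul_div_assoc, ← h]
  field_simp

lemma eis_slash_S : eis ∣[(2 : ℤ)] S = fun z => 1 / 2 * E2 (half z) - E2 z := by
  obtain ⟨c, hc⟩ := exists_E2_S_smul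
  funext z
  have hz := UpperHalfPlane.ne_zero z
  have hd : dbl (S • z) = S • half z := by
    ext
    simp only [dbl, half, UpperHalfPlane.coe_mk, coe_S_smul]
    field_simp
  rw [slash_S_apply, eis, hd, hc, hc, show (-(2 : ℤ)) = -((2 : ℕ) : ℤ) by norm_num, zpow_neg,
    zpow_natCast]
  simp only [half, UpperHalfPlane.coe_mk]
  field_simp
  ring

lemma hasQ_eis_slash_S : HasQ (eis ∣[(2 : ℤ)] S)
    (C (1 / 2) * toC e2Series - toC (PowerSeries.expand 2 (by norm_num) e2Series)) := by
  rw [eis_slash_S]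
  exact (hasQ_E2_half.smul _).sub hasQ_E2

lemma mdiff_eis : MDiff eis := by
  have h1 := _root_.E2_mdifferentiable
  have h2 : eis = E2 ∣[(2 : ℤ)] upperTri 2 0 1 two_pos one_pos - E2 := by
    funext z
    rw [Pi.sub_apply, slash_upperTri, eis]
    have : affinePt 2 0 1 two_pos one_pos z = dbl z := by
      ext
      simp [affinePt, dbl]
    rw [this]
    norm_num
  rw [h2]
  exact (h1.slash 2 _).sub h1

lemma isGammaTwoForm_eis : IsGammaTwoForm 2 eis := by
  refine isGammaTwoForm_of_S_T (by decide) (Or.inl rfl) eis_slash_T ?_ mdiff_eis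
    hasQ_eis.isBounded hasQ_eis_slash_S.isBounded
  funext z
  rw [slash_T_T_apply, hasQ_eis_slash_S.two_vadd]

lemma coeff_zero_eisSeries : coeff 0 eisSeries = 1 := by
  have : constantCoeff e2Series = 1 := by simp [e2Series]
  rw [eisSeries, coeff_zero_eq_constantCoeff, map_sub, map_mul, constantCoeff_expand,
    constantCoeff_expand, this, map_ofNat]
  norm_num

lemma coeff_one_eisSeries : coeff 1 eisSeries = 0 := by
  have h2 : coeff 1 (2 * PowerSeries.expand 4 (by norm_num) e2Series) = 0 := by
    rw [two_mul, map_add, coeff_expand_of_not_dvd _ _ _ (by norm_num)]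
    rfl
  rw [eisSeries, map_sub, h2, coeff_expand_of_not_dvd _ _ _ (by norm_num), sub_zero]

/-- `E₂` is congruent to `1` modulo `3`, hence so is `eis`. -/
lemma map_eisSeries : eisSeries.map (Int.castRingHom (ZMod 3)) = 1 := by
  have h : e2Series.map (Int.castRingHom (ZMod 3)) = 1 := by
    ext n
    rw [PowerSeries.coeff_map, e2Series, coeff_mk, coeff_one]
    split_ifs
    · simp
    · have : ((-24 : ℤ) : ZMod 3) = 0 := by decide
      rw [eq_intCast, Int.cast_mul, this, zero_mul]
  rw [eisSeries, map_sub, map_mul, PowerSeries.map_expand, PowerSeries.map_expand, h, map_one,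
    map_one, map_ofNat]
  norm_num

/-! ### The structure of the ring of modular forms for `Γ(2)` -/

lemma IsGammaTwoForm.exists_hasQ {k : ℤ} {f : ℍ → ℂ} (hf : IsGammaTwoForm k f) :
    ∃ P, HasQ f P := by
  refine ModThree.exists_hasQ (fun z => ?_) hf.holo hf.isBounded
  have hT : T * T ∈ Gamma 2 := by
    change modTwo (T * T) = 1
    decide
  rw [← slash_T_T_apply k f, ← SlashAction.slash_mul, hf.slash_eq _ hT]

lemma isBounded_div {u v : ℍ → ℂ} {c : ℂ} (hu : IsBoundedAtImInfty u)
    (hv : Tendsto v atImInfty (𝓝 c)) (hc : c ≠ 0) : IsBoundedAtImInfty (u / v) := by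
  rw [div_eq_mul_inv]
  exact hu.mul ((hv.inv₀ hc).isBigO_one (F := ℝ))

lemma alpha_ne_zero (z : ℍ) : alpha z ≠ 0 := by
  have h2 : ModularForm.eta (2 * z) ≠ 0 := eta_coe_ne_zero (dbl z)
  exact div_ne_zero (pow_ne_zero _ h2) (pow_ne_zero _ (eta_coe_ne_zero z))

lemma tendsto_beta : Tendsto beta atImInfty (𝓝 1) := by
  have h := hasQ_beta.tendsto
  rwa [PowerSeries.coeff_map, coeff_zero_betaSeries, map_one] at h

lemma isBounded_div_smul_beta {u : ℍ → ℂ} (hu : IsBoundedAtImInfty u) {c : ℂ} (hc : c ≠ 0) :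
    IsBoundedAtImInfty (u / (c • beta)) := by
  have h : Tendsto (c • beta) atImInfty (𝓝 (c * 1)) := tendsto_beta.const_mul c
  exact isBounded_div hu h (by simpa using hc)

/-- A form vanishing at `i∞` is divisible by `alpha`, which has a simple zero at `i∞` and no other
zeros. -/
lemma IsGammaTwoForm.div_alpha {k : ℤ} {f : ℍ → ℂ} {P : PowerSeries ℤ}
    (hf : IsGammaTwoForm (k + 2) f) (hP : HasQ f (toC P)) (h0 : coeff 0 P = 0) :
    IsGammaTwoForm k (f / alpha) ∧ ∃ Q : PowerSeries ℤ, HasQ (f / alpha) (toC Q) := by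
  have hd : MDiff (f / alpha) := by
    have h1 := UpperHalfPlane.mdifferentiable_iff.1 hf.holo
    have h2 := UpperHalfPlane.mdifferentiable_iff.1 mdiff_alpha
    exact UpperHalfPlane.mdifferentiable_iff.2 (h1.div h2 fun z _ => alpha_ne_zero _)
  obtain ⟨R, rfl⟩ := (PowerSeries.X_dvd_iff (φ := P)).2 (by simpa using h0)
  obtain ⟨V, hV⟩ : ∃ V : PowerSeries ℤ, PowerSeries.expand 2 two_ne_zero alphaUnit * V = 1 :=
    ⟨_, PowerSeries.mul_invOfUnit _ 1 (by
      rw [constantCoeff_expand, ← coeff_zero_eq_constantCoeff_apply, coeff_zero_alphaUnit,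
        Units.val_one])⟩
  have hq : HasQ (f / alpha) (toC (V * R)) := by
    have e : f / alpha = (fun z => f z / Periodic.qParam 2 z) /
        (fun z : ℍ => alpha z / Periodic.qParam 2 z) := by
      funext z
      have h1 : Periodic.qParam 2 (z : ℂ) ≠ 0 := Periodic.qParam_ne_zero _
      simp only [Pi.div_apply]
      rw [div_div_div_cancel_right₀ h1]
    have ha := hasQ_alpha
    rw [map_mul, PowerSeries.map_X] at hP
    rw [alphaSeries, map_mul, PowerSeries.map_X] at ha
    have hP' : HasQ (fun z => f z / Periodic.qParam 2 z)
        (toC (PowerSeries.expand 2 two_ne_zero alphaUnit) * toC (V * R)) := by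
      rw [← map_mul, ← mul_assoc, hV, one_mul]
      exact hP.div_qParam
    rw [e]
    refine hP'.div_of_coeff_ne_zero ha.div_qParam ?_ ?_ (e ▸ hd)
    · rw [PowerSeries.coeff_map, coeff_zero_eq_constantCoeff, constantCoeff_expand,
        ← coeff_zero_eq_constantCoeff_apply, coeff_zero_alphaUnit]
      simp
    · exact fun z => div_ne_zero (alpha_ne_zero z) (Periodic.qParam_ne_zero _)
  have hdiv : ∀ γ : SL(2, ℤ), (f / alpha) ∣[k] γ = (f ∣[k + 2] γ) / (alpha ∣[(2 : ℤ)] γ) :=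
      fun γ => by
    rw [← ModularForm.div_slash_SL2, add_sub_cancel_right]
  have hinv : ∀ γ ∈ Gamma 2, (f / alpha) ∣[k] γ = f / alpha := fun γ hγ => by
    rw [hdiv, hf.slash_eq γ hγ, isGammaTwoForm_alpha.slash_eq γ hγ]
  refine ⟨⟨hd, hinv, bounded_slash_of_cusps hinv hq.isBounded ?_ ?_⟩, _, hq⟩
  · rw [hdiv, alpha_slash_S]
    exact isBounded_div_smul_beta (hf.bdd S) (by norm_num)
  · rw [← SlashAction.slash_mul, hdiv, SlashAction.slash_mul _ _ _ alpha, alpha_slash_T,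
      ModularForm.SL_smul_slash, alpha_slash_S, smul_smul]
    exact isBounded_div_smul_beta (hf.bdd _) (by norm_num)

/-- A form of weight `2m` with integral expansion is an integral homogeneous polynomial of degree
`m` in `alpha` and `eis`. -/
theorem IsGammaTwoForm.exists_eq_sum (m : ℕ) {f : ℍ → ℂ} {P : PowerSeries ℤ}
    (hf : IsGammaTwoForm (2 * m) f) (hP : HasQ f (toC P)) :
    ∃ c : ℕ → ℤ, f = ∑ j ∈ Finset.range (m + 1), (c j : ℂ) • (alpha ^ j * eis ^ (m - j)) := by
  induction m generalizing f P with
  | zero =>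
    obtain ⟨a, ha⟩ := (hf.congr (by simp)).eq_const
    have h : toC P = C a := hP.unique fun z => by
      rw [ha]
      exact SumsTo.const _ _
    have h0 : ((coeff 0 P : ℤ) : ℂ) = a := by
      have := congrArg (coeff 0) h
      rwa [PowerSeries.coeff_map, coeff_zero_C] at this
    refine ⟨fun _ => coeff 0 P, ?_⟩
    funext z
    simp only [h0, ha]
    simp
  | succ m ih =>
    obtain ⟨a, ha⟩ : ∃ a : ℤ, coeff 0 P = a := ⟨_, rfl⟩
    obtain ⟨g, hg⟩ : ∃ g, g = f - (a : ℂ) • eis ^ (m + 1) := ⟨_, rfl⟩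
    have hgq : HasQ g (toC (P - C a * eisSeries ^ (m + 1))) := by
      rw [map_sub, map_mul, map_pow, map_C, hg]
      exact hP.sub ((hasQ_eis.pow _).smul _)
    have hgf : IsGammaTwoForm (2 * (m : ℤ) + 2) g := by
      rw [hg]
      refine (hf.congr (by push_cast; ring)).sub (IsGammaTwoForm.smul _ ?_)
      exact (isGammaTwoForm_eis.pow (m + 1)).congr (by push_cast; ring)
    have hg0 : coeff 0 (P - C a * eisSeries ^ (m + 1)) = 0 := by
      have : constantCoeff eisSeries = 1 := by simpa using coeff_zero_eisSeries
      rw [map_sub, coeff_C_mul, ha, coeff_zero_eq_constantCoeff_apply, map_pow, this]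
      simp
    obtain ⟨h1, Q, hQ⟩ := hgf.div_alpha hgq hg0
    obtain ⟨c, hc⟩ := ih h1 hQ
    refine ⟨fun j => if j = 0 then a else c (j - 1), ?_⟩
    rw [Finset.sum_range_succ']
    have hfg : f = g / alpha * alpha + (a : ℂ) • eis ^ (m + 1) := by
      funext z
      have := alpha_ne_zero z
      simp only [hg, Pi.add_apply, Pi.mul_apply, Pi.div_apply, Pi.sub_apply]
      field_simp
      ring
    rw [hc, Finset.sum_mul] at hfg
    simp only [Nat.add_eq_zero_iff, one_ne_zero, and_false, if_false, if_true, Nat.add_sub_cancel,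
      pow_zero, one_mul, Nat.sub_zero, Nat.add_sub_add_right]
    rw [hfg]
    congr 1
    refine Finset.sum_congr rfl fun j _ => ?_
    rw [smul_mul_assoc, pow_succ]
    congr 1
    ring

lemma hasQ_sum_mul_pow {a y : ℍ → ℂ} {P Q : PowerSeries ℤ} (ha : HasQ a (toC P))
    (hy : HasQ y (toC Q)) (m : ℕ) (c : ℕ → ℤ) :
    HasQ (∑ j ∈ Finset.range (m + 1), (c j : ℂ) • (a ^ j * y ^ (m - j)))
      (toC (∑ j ∈ Finset.range (m + 1), C (c j) * (P ^ j * Q ^ (m - j)))) := by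
  rw [map_sum]
  refine HasQ.sum _ fun j _ => ?_
  rw [map_mul, map_mul, map_pow, map_pow, map_C]
  exact ((ha.pow j).mul (hy.pow (m - j))).smul _

/-- An expression of a form by `alpha` and `eis` holds for the expansions as well. -/
lemma eq_sum_of_hasQ {m : ℕ} {f : ℍ → ℂ} {P : PowerSeries ℤ} (hP : HasQ f (toC P)) {c : ℕ → ℤ}
    (hf : f = ∑ j ∈ Finset.range (m + 1), (c j : ℂ) • (alpha ^ j * eis ^ (m - j))) :
    P = ∑ j ∈ Finset.range (m + 1), C (c j) * (alphaSeries ^ j * eisSeries ^ (m - j)) :=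
  toC_injective ((hf ▸ hP).unique (hasQ_sum_mul_pow hasQ_alpha hasQ_eis m c))

lemma coeff_zero_alphaSeries : coeff 0 alphaSeries = 0 := by simp [alphaSeries]

lemma coeff_one_alphaSeries : coeff 1 alphaSeries = 1 := by
  rw [alphaSeries, show 1 = 0 + 1 from rfl, coeff_succ_X_mul, coeff_zero_eq_constantCoeff,
    constantCoeff_expand, ← coeff_zero_eq_constantCoeff_apply, coeff_zero_alphaUnit]

/-- The space of forms of weight two is spanned by `alpha` and `eis`, and coefficients at `1` and
`q` determine the combination. -/
lemma beta_eq_eis_sub : beta = eis - (8 : ℂ) • alpha := by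
  obtain ⟨c, hc⟩ := IsGammaTwoForm.exists_eq_sum 1 (isGammaTwoForm_beta.congr (by norm_num))
    hasQ_beta
  have h := eq_sum_of_hasQ hasQ_beta hc
  have ha0 : constantCoeff alphaSeries = 0 := by simpa using coeff_zero_alphaSeries
  have he0 : constantCoeff eisSeries = 1 := by simpa using coeff_zero_eisSeries
  simp only [Finset.sum_range_succ, Finset.range_zero, Finset.sum_empty, zero_add, pow_zero,
    pow_one, one_mul, mul_one, Nat.sub_zero, Nat.sub_self] at h hc
  have h0 := congrArg (coeff 0) h
  have h1 := congrArg (coeff 1) h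
  rw [map_add, coeff_C_mul, coeff_C_mul, coeff_zero_betaSeries, coeff_zero_alphaSeries,
    coeff_zero_eisSeries] at h0
  rw [map_add, coeff_C_mul, coeff_C_mul, coeff_one_betaSeries, coeff_one_alphaSeries,
    coeff_one_eisSeries] at h1
  have e0 : c 0 = 1 := by linarith
  have e1 : c 1 = -8 := by linarith
  rw [hc, e0, e1]
  push_cast
  funext z
  simp only [Pi.add_apply, Pi.sub_apply, Pi.smul_apply, smul_eq_mul]
  ring

/-! ### Reduction modulo three -/

/-- Reduction modulo `3` of integral power series. -/
abbrev modThree : PowerSeries ℤ →+* PowerSeries (ZMod 3) :=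
  PowerSeries.map (Int.castRingHom (ZMod 3))

/-- The reduction of `alpha` modulo `3`. -/
def alphaMod : PowerSeries (ZMod 3) := modThree alphaSeries

/-- The reduction of `delta` modulo `3`. -/
def deltaMod : PowerSeries (ZMod 3) := modThree deltaSeries

/-- A form of weight `2m` with integral expansion is modulo `3` a polynomial in `alphaMod`, because
`eis ≡ 1`. -/
lemma modThree_eq_sum {m : ℕ} {f : ℍ → ℂ} {P : PowerSeries ℤ} (hP : HasQ f (toC P)) {c : ℕ → ℤ}
    (hf : f = ∑ j ∈ Finset.range (m + 1), (c j : ℂ) • (alpha ^ j * eis ^ (m - j))) :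
    modThree P = ∑ j ∈ Finset.range (m + 1), C (c j : ZMod 3) * alphaMod ^ j := by
  rw [eq_sum_of_hasQ hP hf, map_sum]
  refine Finset.sum_congr rfl fun j _ => ?_
  rw [map_mul, map_mul, map_pow, map_pow, map_C, map_eisSeries, one_pow, mul_one]
  rfl

lemma coeff_deltaMod : coeff 0 deltaMod = 0 ∧ coeff 1 deltaMod = 1 ∧ coeff 2 deltaMod = 0 ∧
    coeff 3 deltaMod = 0 := by
  have h : deltaMod = PowerSeries.X * modThree (PowerSeries.expand 2 two_ne_zero
      (eulerSeries ^ 12)) := by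
    rw [deltaMod, deltaSeries, map_mul, PowerSeries.map_X, map_pow (PowerSeries.expand 2 _)]
  have h0 : constantCoeff eulerSeries = 1 := by simpa using coeff_zero_eulerSeries
  have h2 : coeff 2 (PowerSeries.expand 2 two_ne_zero (eulerSeries ^ 12)) = -12 := by
    rw [show coeff 2 = coeff (R := ℤ) (2 * 1) from rfl, coeff_expand_mul, coeff_one_pow, h0,
      coeff_one_eulerSeries]
    norm_num
  have h1 : coeff 1 (PowerSeries.expand 2 two_ne_zero (eulerSeries ^ 12)) = 0 :=
    coeff_expand_of_not_dvd _ _ _ (by norm_num)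
  have h3 : coeff 0 (PowerSeries.expand 2 two_ne_zero (eulerSeries ^ 12)) = 1 := by
    rw [coeff_zero_eq_constantCoeff, constantCoeff_expand, map_pow, h0, one_pow]
  refine ⟨?_, ?_, ?_, ?_⟩
  · rw [h, coeff_zero_X_mul]
  · rw [h]
    refine (coeff_succ_X_mul 0 _).trans ?_
    rw [PowerSeries.coeff_map, h3, map_one]
  · rw [h]
    refine (coeff_succ_X_mul 1 _).trans ?_
    rw [PowerSeries.coeff_map, h1, map_zero]
  · rw [h]
    refine (coeff_succ_X_mul 2 _).trans ?_
    rw [PowerSeries.coeff_map, h2]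
    decide

lemma exists_alphaMod_eq : ∃ V : PowerSeries (ZMod 3), alphaMod = PowerSeries.X * V ∧
    constantCoeff V = 1 ∧ coeff 1 V = 0 ∧ coeff 2 V = 1 := by
  refine ⟨modThree (PowerSeries.expand 2 two_ne_zero alphaUnit), ?_, ?_, ?_, ?_⟩
  · rw [alphaMod, alphaSeries, map_mul, PowerSeries.map_X]
  · rw [← coeff_zero_eq_constantCoeff_apply, PowerSeries.coeff_map, coeff_zero_eq_constantCoeff,
      constantCoeff_expand, ← coeff_zero_eq_constantCoeff_apply, coeff_zero_alphaUnit, map_one]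
  · rw [PowerSeries.coeff_map, coeff_expand_of_not_dvd _ _ _ (by norm_num), map_zero]
  · rw [PowerSeries.coeff_map, show coeff 2 = coeff (R := ℤ) (2 * 1) from rfl, coeff_expand_mul,
      coeff_one_alphaUnit]
    decide

/-- The congruence `D₂ ≡ F - F³` modulo `3`. -/
lemma deltaMod_eq : deltaMod = alphaMod - alphaMod ^ 3 := by
  obtain ⟨c, hc⟩ := IsGammaTwoForm.exists_eq_sum 3 (isGammaTwoForm_delta.congr (by norm_num))
    hasQ_delta
  have h : deltaMod = _ := modThree_eq_sum hasQ_delta hc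
  obtain ⟨V, hV, hV0, hV1, hV2⟩ := exists_alphaMod_eq
  obtain ⟨d0, d1, d2, d3⟩ := coeff_deltaMod
  simp only [Finset.sum_range_succ, Finset.range_zero, Finset.sum_empty, zero_add, pow_zero,
    pow_one, mul_one] at h
  have e : ∀ n, coeff n deltaMod = _ := fun n => congrArg (coeff n) h
  simp only [map_add, coeff_C_mul, coeff_C, hV, mul_pow, coeff_X_pow_mul'] at e
  have e0 := e 0
  have e1 := e 1
  have e2 := e 2
  have e3 := e 3
  simp [coeff_succ_X_mul, coeff_one_pow, hV0, hV1, hV2, d0, d1, d2, d3] at e0 e1 e2 e3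
  have e4 : (c 3 : ZMod 3) = -1 := by linear_combination -e3 + e1
  rw [h, ← e0, ← e1, ← e2, e4]
  simp only [map_zero, map_one, map_neg]
  ring

/-! ### Hecke operators on `Γ(2)` -/

/-- Representatives of the cosets of `Γ(2)` in the set of integral matrices of determinant `l` that
are congruent to `1` modulo `2`, for an odd prime `l`. -/
def heckeMat (l : ℕ) : Option (Fin l) → Matrix (Fin 2) (Fin 2) ℤ
  | none => !![(l : ℤ), 0; 0, 1]
  | some j => !![1, 2 * (j : ℤ); 0, (l : ℤ)]

lemma mem_gammaTwo_iff (γ : SL(2, ℤ)) :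
    γ ∈ Gamma 2 ↔ Odd (γ 0 0) ∧ Even (γ 0 1) ∧ Even (γ 1 0) ∧ Odd (γ 1 1) := by
  rw [Gamma_mem]
  simp only [ZMod.intCast_eq_one_iff_odd, ZMod.intCast_eq_zero_iff_even]

lemma exists_fin_modEq {l : ℕ} (hl : l.Prime) (hl2 : Odd l) {a b : ℤ} (ha : ¬ (l : ℤ) ∣ a) :
    ∃ j : Fin l, (l : ℤ) ∣ b - 2 * j * a := by
  have : Fact l.Prime := ⟨hl⟩
  have h2 : ((2 : ℤ) * a : ZMod l) ≠ 0 := by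
    rw [← Int.cast_mul, Ne, ZMod.intCast_zmod_eq_zero_iff_dvd]
    intro h
    rcases (Nat.prime_iff_prime_int.1 hl).dvd_mul.1 h with h | h
    · have : l ∣ 2 := by exact_mod_cast h
      rcases (Nat.prime_two.eq_one_or_self_of_dvd l this) with rfl | rfl
      · exact hl.ne_one rfl
      · exact absurd hl2 (by decide)
    · exact ha h
  set x : ZMod l := (b : ZMod l) / ((2 : ℤ) * a : ZMod l)
  refine ⟨⟨x.val, ZMod.val_lt x⟩, ?_⟩
  rw [← ZMod.intCast_zmod_eq_zero_iff_dvd]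
  have hx : ((x.val : ℕ) : ZMod l) = x := ZMod.natCast_zmod_val x
  push_cast
  rw [hx, sub_eq_zero]
  have := div_mul_cancel₀ (b : ZMod l) h2
  rw [← this]
  push_cast
  ring

/-- Integral matrices of determinant `l` that are congruent to `1` modulo `2` lie in one of the
cosets. If `l` divides the first column the representative is diagonal; otherwise `j` is found by
dividing by an entry of that column modulo `l`. -/
lemma exists_eq_mul_heckeMat {l : ℕ} (hl : l.Prime) (hl2 : Odd l)
    (N : Matrix (Fin 2) (Fin 2) ℤ) (hdet : N.det = l) (h00 : Odd (N 0 0)) (h01 : Even (N 0 1))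
    (h10 : Even (N 1 0)) (h11 : Odd (N 1 1)) :
    ∃ δ ∈ Gamma 2, ∃ i, N = δ.1 * heckeMat l i := by
  have hl0 : (l : ℤ) ≠ 0 := by exact_mod_cast hl.ne_zero
  have hl2' : Odd (l : ℤ) := by exact_mod_cast hl2
  have hp : Prime (l : ℤ) := Nat.prime_iff_prime_int.1 hl
  rw [Matrix.det_fin_two] at hdet
  have main : ∀ j : Fin l, (l : ℤ) ∣ N 0 1 - 2 * j * N 0 0 → (l : ℤ) ∣ N 1 1 - 2 * j * N 1 0 →
      ∃ δ ∈ Gamma 2, ∃ i, N = δ.1 * heckeMat l i := by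
    rintro j ⟨b, hb⟩ ⟨d, hd⟩
    refine ⟨⟨!![N 0 0, b; N 1 0, d], ?_⟩, ?_, some j, ?_⟩
    · rw [Matrix.det_fin_two_of]
      refine mul_left_cancel₀ hl0 ?_
      linear_combination hdet - N 0 0 * hd + N 1 0 * hb
    · refine (mem_gammaTwo_iff _).2 ⟨h00, ?_, h10, ?_⟩
      · have : Even ((l : ℤ) * b) := by
          rw [← hb]
          exact h01.sub ⟨j * N 0 0, by ring⟩
        exact (Int.even_mul.1 this).resolve_left (Int.not_even_iff_odd.2 hl2')
      · have : Odd ((l : ℤ) * d) := by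
          rw [← hd]
          exact h11.sub_even ⟨j * N 1 0, by ring⟩
        exact (Int.odd_mul.1 this).2
    · ext a c
      fin_cases a <;> fin_cases c <;>
        simp [heckeMat, Matrix.mul_apply, Fin.sum_univ_two]
      · linear_combination hb
      · linear_combination hd
  by_cases hc : (l : ℤ) ∣ N 0 0
  · by_cases hr : (l : ℤ) ∣ N 1 0
    · obtain ⟨a, ha⟩ := hc
      obtain ⟨c, hc⟩ := hr
      refine ⟨⟨!![a, N 0 1; c, N 1 1], ?_⟩, ?_, none, ?_⟩
      · rw [Matrix.det_fin_two_of]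
        refine mul_left_cancel₀ hl0 ?_
        linear_combination hdet - N 1 1 * ha + N 0 1 * hc
      · refine (mem_gammaTwo_iff _).2 ⟨?_, h01, ?_, h11⟩
        · rw [ha] at h00
          exact (Int.odd_mul.1 h00).2
        · rw [hc] at h10
          exact (Int.even_mul.1 h10).resolve_left (Int.not_even_iff_odd.2 hl2')
      · ext i j
        fin_cases i <;> fin_cases j <;>
          simp [heckeMat, Matrix.mul_apply, Fin.sum_univ_two]
        · linear_combination ha
        · linear_combination hc
    · obtain ⟨j, hj⟩ := exists_fin_modEq hl hl2 (b := N 1 1) hr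
      refine main j ?_ hj
      refine (hp.dvd_or_dvd (a := N 1 0) ?_).resolve_left hr
      have : N 1 0 * (N 0 1 - 2 * j * N 0 0) = N 0 0 * (N 1 1 - 2 * j * N 1 0) - l := by
        linear_combination -hdet
      rw [this]
      exact dvd_sub (hj.mul_left _) dvd_rfl
  · obtain ⟨j, hj⟩ := exists_fin_modEq hl hl2 (b := N 0 1) hc
    refine main j hj ?_
    refine (hp.dvd_or_dvd (a := N 0 0) ?_).resolve_left hc
    have : N 0 0 * (N 1 1 - 2 * j * N 1 0) = N 1 0 * (N 0 1 - 2 * j * N 0 0) + l := by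
      linear_combination hdet
    rw [this]
    exact dvd_add (hj.mul_left _) dvd_rfl

/-- The matrices `heckeMat` lie in distinct cosets, even of `SL(2, ℤ)`. -/
lemma heckeMat_injective {l : ℕ} (hl : l.Prime) (hl2 : Odd l) (ε : SL(2, ℤ))
    {i i' : Option (Fin l)} (h : heckeMat l i = ε.1 * heckeMat l i') : i = i' := by
  have hp : Prime (l : ℤ) := Nat.prime_iff_prime_int.1 hl
  have hdet := ε.2
  rw [Matrix.det_fin_two] at hdet
  have h00 := congrFun (congrFun h 0) 0
  have h01 := congrFun (congrFun h 0) 1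
  have h10 := congrFun (congrFun h 1) 0
  have h11 := congrFun (congrFun h 1) 1
  cases i with
  | none =>
    cases i' with
    | none => rfl
    | some j =>
      simp [heckeMat, Matrix.mul_apply, Fin.sum_univ_two] at h00 h10
      rw [← h00, ← h10, mul_zero, sub_zero] at hdet
      exact absurd (isUnit_iff_dvd_one.2 ⟨_, hdet.symm⟩) hp.not_isUnit
  | some j =>
    cases i' with
    | none =>
      simp [heckeMat, Matrix.mul_apply, Fin.sum_univ_two] at h00
      exact absurd (isUnit_iff_dvd_one.2 ⟨ε 0 0, by rw [mul_comm]; exact h00⟩) hp.not_isUnit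
    | some j' =>
      simp [heckeMat, Matrix.mul_apply, Fin.sum_univ_two] at h00 h01
      rw [← h00, one_mul] at h01
      have hd : (l : ℤ) ∣ 2 * ((j : ℤ) - j') := ⟨ε 0 1, by linear_combination h01⟩
      have h2 : ¬ (l : ℤ) ∣ 2 := by
        intro h
        have : l ∣ 2 := by exact_mod_cast h
        rcases (Nat.prime_two.eq_one_or_self_of_dvd l this) with rfl | rfl
        · exact hl.ne_one rfl
        · exact absurd hl2 (by decide)
      have := (hp.dvd_mul.1 hd).resolve_left h2
      have hj := j.2
      have hj' := j'.2
      have h0 : (j : ℤ) - j' = 0 := by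
        refine Int.eq_zero_of_abs_lt_dvd this ?_
        rw [abs_lt]
        omega
      congr 1
      ext
      omega

/-- Conjugation by an element of `SL(2, ℤ)` permutes the cosets of `Γ(2)`, because this subgroup is
normal. -/
lemma exists_perm_heckeMat {l : ℕ} (hl : l.Prime) (hl2 : Odd l) (γ : SL(2, ℤ)) :
    ∃ (π : Equiv.Perm (Option (Fin l))) (δ : Option (Fin l) → SL(2, ℤ)), (∀ i, δ i ∈ Gamma 2) ∧
      ∀ i, heckeMat l i * γ.1 = (γ * δ i).1 * heckeMat l (π i) := by
  have h : ∀ i, ∃ δ ∈ Gamma 2, ∃ j, heckeMat l i * γ.1 = (γ * δ).1 * heckeMat l j := by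
    intro i
    have hdet : (heckeMat l i).det = l := by
      cases i <;> simp [heckeMat, Matrix.det_fin_two]
    have hmap : (heckeMat l i).map (Int.castRingHom (ZMod 2)) = 1 := by
      have hl' : (l : ZMod 2) = 1 := ZMod.natCast_eq_one_iff_odd.2 hl2
      have h2 : (2 : ZMod 2) = 0 := rfl
      cases i <;> ext a b <;> fin_cases a <;> fin_cases b <;> simp [heckeMat, hl', h2]
    set N := (γ⁻¹).1 * heckeMat l i * γ.1 with hN
    have hNmap : N.map (Int.castRingHom (ZMod 2)) = 1 := by
      rw [hN, Matrix.map_mul, Matrix.map_mul, hmap, Matrix.mul_one, ← Matrix.map_mul,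
        ← Matrix.SpecialLinearGroup.coe_mul, inv_mul_cancel]
      simp
    have hent : ∀ a b, ((N a b : ℤ) : ZMod 2) = (1 : Matrix (Fin 2) (Fin 2) (ZMod 2)) a b :=
      fun a b => by rw [← hNmap]; rfl
    have hNdet : N.det = l := by
      rw [hN, Matrix.det_mul, Matrix.det_mul, hdet, γ.2, (γ⁻¹).2]
      ring
    obtain ⟨δ, hδ, j, hj⟩ := exists_eq_mul_heckeMat hl hl2 N hNdet
      (ZMod.intCast_eq_one_iff_odd.1 (by simpa using hent 0 0))
      (ZMod.intCast_eq_zero_iff_even.1 (by simpa using hent 0 1))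
      (ZMod.intCast_eq_zero_iff_even.1 (by simpa using hent 1 0))
      (ZMod.intCast_eq_one_iff_odd.1 (by simpa using hent 1 1))
    refine ⟨δ, hδ, j, ?_⟩
    rw [Matrix.SpecialLinearGroup.coe_mul, Matrix.mul_assoc, ← hj, hN, ← Matrix.mul_assoc,
      ← Matrix.mul_assoc, ← Matrix.SpecialLinearGroup.coe_mul, mul_inv_cancel,
      Matrix.SpecialLinearGroup.coe_one, Matrix.one_mul]
  choose δ hδ p hp using h
  have hinj : Injective p := by
    intro i i' hii
    refine heckeMat_injective hl hl2 (γ * δ i * (γ * δ i')⁻¹) ?_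
    have h1 : heckeMat l (p i') = (γ * δ i')⁻¹.1 * (heckeMat l i' * γ.1) := by
      rw [hp i', ← Matrix.mul_assoc, ← Matrix.SpecialLinearGroup.coe_mul, inv_mul_cancel,
        Matrix.SpecialLinearGroup.coe_one, Matrix.one_mul]
    have h2 : heckeMat l i = heckeMat l i * γ.1 * (γ⁻¹).1 := by
      rw [Matrix.mul_assoc, ← Matrix.SpecialLinearGroup.coe_mul, mul_inv_cancel,
        Matrix.SpecialLinearGroup.coe_one, Matrix.mul_one]
    have h3 : γ.1 * (γ⁻¹).1 = 1 := by
      rw [← Matrix.SpecialLinearGroup.coe_mul, mul_inv_cancel, Matrix.SpecialLinearGroup.coe_one]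
    rw [h2, hp i, hii, h1, Matrix.SpecialLinearGroup.coe_mul (γ * δ i)]
    simp only [Matrix.mul_assoc]
    rw [h3, Matrix.mul_one]
  exact ⟨Equiv.ofBijective p (Finite.injective_iff_bijective.1 hinj), δ, hδ, hp⟩

/-- The matrices `heckeMat` in `GL(2, ℝ)`. -/
def heckeRep (l : ℕ) (hl : 0 < l) : Option (Fin l) → GL (Fin 2) ℝ
  | none => upperTri l 0 1 (by exact_mod_cast hl) one_pos
  | some j => upperTri 1 (2 * j) l one_pos (by exact_mod_cast hl)

lemma coe_heckeRep (l : ℕ) (hl : 0 < l) (i : Option (Fin l)) :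
    (heckeRep l hl i).1 = (heckeMat l i).map (Int.cast : ℤ → ℝ) := by
  cases i <;> ext a b <;> fin_cases a <;> fin_cases b <;>
    simp [heckeRep, heckeMat, upperTri, Matrix.GeneralLinearGroup.mkOfDetNeZero]

/-- The Hecke operator `T_l` of weight `k` on functions on the upper half plane. -/
def heckeOp (k : ℤ) (l : ℕ) (hl : 0 < l) (f : ℍ → ℂ) : ℍ → ℂ :=
  ∑ i, f ∣[k] heckeRep l hl i

/-- On `Γ(2)`-invariant functions the Hecke operators commute with all of `SL(2, ℤ)`. -/
lemma heckeOp_slash {k : ℤ} {l : ℕ} (hl : l.Prime) (hl2 : Odd l) {f : ℍ → ℂ}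
    (hf : IsGammaTwoForm k f) (γ : SL(2, ℤ)) :
    heckeOp k l hl.pos f ∣[k] γ = heckeOp k l hl.pos (f ∣[k] γ) := by
  obtain ⟨π, δ, hδ, h⟩ := exists_perm_heckeMat hl hl2 γ
  have hrep : ∀ i, heckeRep l hl.pos i * (γ : GL (Fin 2) ℝ) =
      ((γ * δ i : SL(2, ℤ)) : GL (Fin 2) ℝ) * heckeRep l hl.pos (π i) := fun i => by
    ext a b
    have h1 := congrArg (fun M : Matrix (Fin 2) (Fin 2) ℤ => (M a b : ℝ)) (h i)
    simp only [Matrix.mul_apply, Fin.sum_univ_two] at h1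
    push_cast at h1
    rw [Units.val_mul, Units.val_mul, coe_heckeRep, coe_heckeRep]
    simpa [Matrix.mul_apply, Fin.sum_univ_two] using h1
  rw [heckeOp, SlashAction.sum_slash, heckeOp,
    ← Equiv.sum_comp π fun i => (f ∣[k] γ) ∣[k] heckeRep l hl.pos i]
  refine Finset.sum_congr rfl fun i _ => ?_
  rw [ModularForm.SL_slash, ← SlashAction.slash_mul, hrep, SlashAction.slash_mul,
    ← ModularForm.SL_slash, SlashAction.slash_mul, (hf.slash γ).slash_eq _ (hδ i)]

lemma sum_pow_root {l : ℕ} (hl : 0 < l) (n : ℕ) :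
    ∑ j : Fin l, Complex.exp (2 * Real.pi * Complex.I / l) ^ ((j : ℕ) * n) =
      if l ∣ n then (l : ℂ) else 0 := by
  have hζ := Complex.isPrimitiveRoot_exp l hl.ne'
  set ζ := Complex.exp (2 * Real.pi * Complex.I / l)
  have h1 : ∀ j : ℕ, ζ ^ (j * n) = (ζ ^ n) ^ j := fun j => by rw [← pow_mul, mul_comm]
  simp only [h1]
  rw [Fin.sum_univ_eq_sum_range (fun j => (ζ ^ n) ^ j) l]
  split_ifs with h
  · rw [hζ.pow_eq_one_iff_dvd n |>.2 h]
    simp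
  · have hne : ζ ^ n ≠ 1 := fun h' => h ((hζ.pow_eq_one_iff_dvd n).1 h')
    rw [geom_sum_eq hne, ← pow_mul, mul_comm, pow_mul, hζ.pow_eq_one]
    simp

/-- The Hecke operator acts on expansions in powers of `exp(π i z)` by the usual formula. The
translations `2j` in `heckeRep` keep this true for forms of period two. -/
lemma HasQ.heckeOp {k : ℤ} {l : ℕ} (hl : 0 < l) {f : ℍ → ℂ} {P : PowerSeries ℂ}
    (hf : HasQ f P) : HasQ (heckeOp k l hl f) (heckeWeight ℂ k l P) := by
  intro z
  have hl0 : (l : ℂ) ≠ 0 := by exact_mod_cast hl.ne'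
  have hlr : (l : ℝ) ≠ 0 := by exact_mod_cast hl.ne'
  have hlp : (0 : ℝ) < l := by exact_mod_cast hl
  set q := Periodic.qParam 2 z
  -- the term of the matrix `(l, 0; 0, 1)`
  have h1 : SumsTo (C ((l : ℂ) ^ (k - 1)) * PowerSeries.expand l hl.ne' P) q
      ((f ∣[k] heckeRep l hl none) z) := by
    rw [heckeRep, slash_upperTri]
    have e : Periodic.qParam 2 (affinePt l 0 1 hlp one_pos z) = q ^ l := by
      rw [qParam_pow]
      simp [affinePt]
    have := (SumsTo.expand hl.ne' (e ▸ hf (affinePt l 0 1 hlp one_pos z))).const_mul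
      ((l : ℂ) ^ (k - 1))
    simpa using this
  have h2 : SumsTo (PowerSeries.mk fun n => coeff (l * n) P) q
      (∑ j : Fin l, (f ∣[k] heckeRep l hl (some j)) z) := by
    set w := Periodic.qParam 2 ((z : ℂ) / l) with hw
    have hwl : w ^ l = q := by
      rw [hw, qParam_pow, mul_div_cancel₀ _ hl0]
    set ζ := Complex.exp (2 * Real.pi * Complex.I / l) with hζ
    have hj : ∀ j : Fin l, HasSum (fun n => (l : ℂ)⁻¹ * (coeff n P * (ζ ^ (j : ℕ) * w) ^ n))
        ((f ∣[k] heckeRep l hl (some j)) z) := fun j => by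
      rw [heckeRep, slash_upperTri]
      have := (hf (affinePt 1 (2 * j) l one_pos hlp z)).mul_left ((l : ℂ)⁻¹)
      have e : Periodic.qParam 2 (affinePt 1 (2 * j) l one_pos hlp z) = ζ ^ (j : ℕ) * w := by
        rw [hw, hζ, ← Complex.exp_nat_mul, Periodic.qParam, Periodic.qParam, ← Complex.exp_add]
        congr 1
        simp only [affinePt, UpperHalfPlane.coe_mk]
        push_cast
        field_simp
        ring
      rw [e] at this
      simpa using this
    have hs := hasSum_sum (s := Finset.univ) fun j _ => hj j
    have e : (fun n => ∑ j : Fin l, (l : ℂ)⁻¹ * (coeff n P * (ζ ^ (j : ℕ) * w) ^ n)) =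
        fun n => if l ∣ n then coeff n P * w ^ n else 0 := by
      funext n
      have := sum_pow_root hl n
      have e1 : ∀ j : Fin l, (l : ℂ)⁻¹ * (coeff n P * (ζ ^ (j : ℕ) * w) ^ n) =
          (l : ℂ)⁻¹ * (coeff n P * w ^ n) * ζ ^ ((j : ℕ) * n) := fun j => by
        rw [mul_pow, ← pow_mul]
        ring
      simp only [e1]
      rw [← Finset.mul_sum, this]
      split_ifs
      · field_simp
      · simp
    rw [e] at hs
    have hinj : Injective fun n : ℕ => l * n := fun _ _ h =>
      Nat.eq_of_mul_eq_mul_left hl h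
    rw [← hinj.hasSum_iff] at hs
    · refine SumsTo.of_hasSum hs fun n => ?_
      simp [← hwl, pow_mul]
    · intro n hn
      rw [if_neg]
      rintro ⟨m, rfl⟩
      exact hn ⟨m, rfl⟩
  have h3 : heckeWeight ℂ k l P = C ((l : ℂ) ^ (k - 1)) * PowerSeries.expand l hl.ne' P +
      PowerSeries.mk fun n => coeff (l * n) P := by
    ext n
    rw [map_add, coeff_C_mul, coeff_mk, add_comm]
    simp only [heckeWeight, LinearMap.coe_mk, AddHom.coe_mk, coeff_mk]
    congr 2
    split_ifs with h
    · obtain ⟨m, rfl⟩ := h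
      rw [coeff_expand_mul, Nat.mul_div_cancel_left _ hl]
    · rw [coeff_expand_of_not_dvd _ _ _ h]
  rw [h3, ModThree.heckeOp, Finset.sum_apply, Fintype.sum_option]
  exact h1.add h2

lemma IsGammaTwoForm.heckeOp {k : ℤ} {l : ℕ} (hl : l.Prime) (hl2 : Odd l) {f : ℍ → ℂ}
    (hf : IsGammaTwoForm k f) : IsGammaTwoForm k (heckeOp k l hl.pos f) where
  holo := by
    rw [ModThree.heckeOp]
    refine MDifferentiable.sum fun i _ => ?_
    exact hf.holo.slash k _
  slash_eq γ hγ := by rw [heckeOp_slash hl hl2 hf, hf.slash_eq γ hγ]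
  bdd γ := by
    rw [heckeOp_slash hl hl2 hf]
    obtain ⟨P, hP⟩ := (hf.slash γ).exists_hasQ
    exact (hP.heckeOp hl.pos).isBounded

/-- In positive even weight the Hecke operator is integral, and reduces to `heckeT`. -/
lemma exists_heckeT {k : ℤ} (hk : Even k) (hk1 : 1 ≤ k) {l : ℕ} (hl : ¬ 3 ∣ l)
    (P : PowerSeries ℤ) : ∃ Q : PowerSeries ℤ, toC Q = heckeWeight ℂ k l (toC P) ∧
      modThree Q = heckeT l (modThree P) := by
  obtain ⟨m, hm⟩ : ∃ m : ℕ, k - 1 = m := ⟨(k - 1).toNat, by omega⟩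
  refine ⟨PowerSeries.mk fun n => coeff (l * n) P + l ^ m * if l ∣ n then coeff (n / l) P else 0,
    ?_, ?_⟩
  · ext n
    simp only [heckeWeight, LinearMap.coe_mk, AddHom.coe_mk, coeff_mk, PowerSeries.coeff_map, hm,
      zpow_natCast]
    split_ifs <;> simp
  · rw [← heckeWeight_even k hk l hl]
    ext n
    simp only [heckeWeight, LinearMap.coe_mk, AddHom.coe_mk, coeff_mk, PowerSeries.coeff_map, hm,
      zpow_natCast]
    split_ifs <;> simp

/-! ### The action of the element `ST` of order three -/

lemma pow_slash (k : ℤ) (n : ℕ) (f : ℍ → ℂ) (γ : SL(2, ℤ)) :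
    (f ^ n) ∣[n * k] γ = (f ∣[k] γ) ^ n := by
  induction n with
  | zero => simpa using ModularForm.is_invariant_one γ
  | succ n ih =>
    have h : ((n + 1 : ℕ) : ℤ) * k = n * k + k := by push_cast; ring
    rw [pow_succ, h, ModularForm.mul_slash_SL2, ih, pow_succ]

lemma sum_slash_alpha_eis {m : ℕ} (c : ℕ → ℂ) (γ : SL(2, ℤ)) :
    (∑ j ∈ Finset.range (m + 1), c j • (alpha ^ j * eis ^ (m - j))) ∣[2 * (m : ℤ)] γ =
      ∑ j ∈ Finset.range (m + 1),
        c j • ((alpha ∣[(2 : ℤ)] γ) ^ j * (eis ∣[(2 : ℤ)] γ) ^ (m - j)) := by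
  rw [SlashAction.sum_slash]
  refine Finset.sum_congr rfl fun j hj => ?_
  have hjm : j ≤ m := Nat.lt_succ_iff.1 (Finset.mem_range.1 hj)
  have h : 2 * (m : ℤ) = j * 2 + ((m - j : ℕ) : ℤ) * 2 := by
    push_cast [hjm]; ring
  rw [ModularForm.SL_smul_slash, h, ModularForm.mul_slash_SL2, pow_slash, pow_slash]

lemma alpha_slash_ST : alpha ∣[(2 : ℤ)] (S * T) = (-1 / 16 : ℂ) • (eis + (8 : ℂ) • alpha) := by
  rw [SlashAction.slash_mul, alpha_slash_S, ModularForm.SL_smul_slash, beta_eq_eis_sub,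
    sub_eq_add_neg, SlashAction.add_slash, SlashAction.neg_slash, ModularForm.SL_smul_slash,
    alpha_slash_T, eis_slash_T, one_smul, smul_smul]
  norm_num

lemma eis_slash_ST :
    eis ∣[(2 : ℤ)] (S * T) = (-1 / 16 : ℂ) • ((8 : ℂ) • eis - (192 : ℂ) • alpha) := by
  have hbS : beta ∣[(2 : ℤ)] S = (-16 : ℂ) • alpha := by
    rw [beta_eq, ModularForm.SL_smul_slash, slash_S_slash_S (by decide)]
  have h : eis = beta + (8 : ℂ) • alpha := by rw [beta_eq_eis_sub]; abel
  have hbT : beta ∣[(2 : ℤ)] T = eis + (8 : ℂ) • alpha := by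
    rw [beta_eq_eis_sub, sub_eq_add_neg, SlashAction.add_slash, SlashAction.neg_slash,
      ModularForm.SL_smul_slash, alpha_slash_T, eis_slash_T, one_smul]
    funext z
    simp only [Pi.add_apply, Pi.smul_apply, Pi.neg_apply, smul_eq_mul]
    ring
  conv_lhs => rw [h]
  rw [SlashAction.slash_mul, SlashAction.add_slash, hbS, ModularForm.SL_smul_slash, alpha_slash_S,
    SlashAction.add_slash, ModularForm.SL_smul_slash, ModularForm.SL_smul_slash,
    ModularForm.SL_smul_slash, alpha_slash_T, hbT]
  funext z
  simp only [Pi.add_apply, Pi.smul_apply, Pi.sub_apply, smul_eq_mul]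
  ring

lemma alpha_slash_ST_ST : (alpha ∣[(2 : ℤ)] (S * T)) ∣[(2 : ℤ)] (S * T) =
    (-1 / 16 : ℂ) • ((8 : ℂ) • alpha - eis) := by
  conv_lhs => rw [alpha_slash_ST]
  rw [ModularForm.SL_smul_slash, SlashAction.add_slash, ModularForm.SL_smul_slash, eis_slash_ST,
    alpha_slash_ST]
  funext z
  simp only [Pi.add_apply, Pi.smul_apply, Pi.sub_apply, smul_eq_mul]
  ring

lemma eis_slash_ST_ST : (eis ∣[(2 : ℤ)] (S * T)) ∣[(2 : ℤ)] (S * T) =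
    (-1 / 16 : ℂ) • ((8 : ℂ) • eis + (192 : ℂ) • alpha) := by
  conv_lhs => rw [eis_slash_ST]
  rw [ModularForm.SL_smul_slash, sub_eq_add_neg, SlashAction.add_slash, SlashAction.neg_slash,
    ModularForm.SL_smul_slash, ModularForm.SL_smul_slash, eis_slash_ST, alpha_slash_ST]
  funext z
  simp only [Pi.add_apply, Pi.smul_apply, Pi.sub_apply, Pi.neg_apply, smul_eq_mul]
  ring

lemma delta_slash_ST : delta ∣[(6 : ℤ)] (S * T) = delta := by
  rw [SlashAction.slash_mul, delta_slash_S, ModularForm.SL_smul_slash, delta_slash_T, smul_smul]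
  norm_num

/-- The trace of `f` under the cyclic group of order three generated by the image of `ST`. -/
def traceST (k : ℤ) (f : ℍ → ℂ) : ℍ → ℂ :=
  f + f ∣[k] (S * T) + (f ∣[k] (S * T)) ∣[k] (S * T)

lemma traceST_alpha : traceST 2 alpha = 0 := by
  rw [traceST, alpha_slash_ST_ST, alpha_slash_ST]
  funext z
  simp only [Pi.add_apply, Pi.smul_apply, Pi.sub_apply, smul_eq_mul, Pi.zero_apply]
  ring

lemma traceST_eis : traceST 2 eis = 0 := by
  rw [traceST, eis_slash_ST_ST, eis_slash_ST]
  funext z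
  simp only [Pi.add_apply, Pi.smul_apply, Pi.sub_apply, smul_eq_mul, Pi.zero_apply]
  ring

lemma traceST_delta_pow_mul {k : ℤ} (i : ℕ) {f : ℍ → ℂ} (hf : traceST k f = 0) :
    traceST (i * 6 + k) (delta ^ i * f) = 0 := by
  rw [traceST, ModularForm.mul_slash_SL2, ModularForm.mul_slash_SL2, pow_slash, delta_slash_ST,
    pow_slash, delta_slash_ST, ← mul_add, ← mul_add, ← traceST, hf, mul_zero]

lemma traceST_heckeOp {k : ℤ} {l : ℕ} (hl : l.Prime) (hl2 : Odd l) {f : ℍ → ℂ}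
    (hf : IsGammaTwoForm k f) (h0 : traceST k f = 0) :
    traceST k (heckeOp k l hl.pos f) = 0 := by
  rw [traceST, heckeOp_slash hl hl2 hf, heckeOp_slash hl hl2 (hf.slash _)]
  have : heckeOp k l hl.pos f + heckeOp k l hl.pos (f ∣[k] (S * T)) +
      heckeOp k l hl.pos ((f ∣[k] (S * T)) ∣[k] (S * T)) = heckeOp k l hl.pos (traceST k f) := by
    simp only [heckeOp, traceST, SlashAction.add_slash, Finset.sum_add_distrib]
  rw [this, h0]
  simp [heckeOp]

/-- Homogeneity of the forms of degree `m` in two functions. -/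
lemma sum_smul_pow_mul_smul_pow (t : ℂ) (a y : ℍ → ℂ) (m : ℕ) (c : ℕ → ℂ) :
    ∑ j ∈ Finset.range (m + 1), c j • ((t • a) ^ j * (t • y) ^ (m - j)) =
      t ^ m • ∑ j ∈ Finset.range (m + 1), c j • (a ^ j * y ^ (m - j)) := by
  rw [Finset.smul_sum]
  refine Finset.sum_congr rfl fun j hj => ?_
  have hjm : j ≤ m := Nat.lt_succ_iff.1 (Finset.mem_range.1 hj)
  rw [smul_pow, smul_pow, smul_mul_smul_comm, ← pow_add, Nat.add_sub_cancel' hjm, smul_comm]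

/-- For a polynomial in `alpha` and `eis`, a vanishing trace means modulo `3` that the sum of the
translates of the polynomial by `𝔽₃` vanishes at `alphaMod`. -/
lemma sum_translates_eq_zero {m : ℕ} (c : ℕ → ℤ)
    (h : traceST (2 * m)
      (∑ j ∈ Finset.range (m + 1), (c j : ℂ) • (alpha ^ j * eis ^ (m - j))) = 0) :
    ∑ j ∈ Finset.range (m + 1), C (c j : ZMod 3) *
      (alphaMod ^ j + (alphaMod - 1) ^ j + (alphaMod + 1) ^ j) = 0 := by
  have hmul : ∀ (a : ℤ) {f : ℍ → ℂ} {P : PowerSeries ℤ}, HasQ f (toC P) →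
      HasQ ((a : ℂ) • f) (toC (C a * P)) := fun a f P hf => by
    rw [map_mul, map_C]
    exact hf.smul _
  have h8A := hmul 8 hasQ_alpha
  have h8Y := hmul 8 hasQ_eis
  have h192 := hmul 192 hasQ_alpha
  simp only [Int.cast_ofNat] at h8A h8Y h192
  have q1 := hasQ_sum_mul_pow hasQ_alpha hasQ_eis m c
  have q2 := hasQ_sum_mul_pow (P := eisSeries + C 8 * alphaSeries)
    (Q := C 8 * eisSeries - C 192 * alphaSeries) (by rw [map_add]; exact hasQ_eis.add h8A)
    (by rw [map_sub]; exact h8Y.sub h192) m c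
  have q3 := hasQ_sum_mul_pow (P := C 8 * alphaSeries - eisSeries)
    (Q := C 8 * eisSeries + C 192 * alphaSeries) (by rw [map_sub]; exact h8A.sub hasQ_eis)
    (by rw [map_add]; exact h8Y.add h192) m c
  rw [traceST, ← SlashAction.slash_mul, sum_slash_alpha_eis, sum_slash_alpha_eis,
    SlashAction.slash_mul _ (S * T) (S * T) alpha, SlashAction.slash_mul _ (S * T) (S * T) eis,
    alpha_slash_ST_ST,
    eis_slash_ST_ST, alpha_slash_ST, eis_slash_ST, sum_smul_pow_mul_smul_pow,
    sum_smul_pow_mul_smul_pow] at h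
  have h1 := (((hmul ((-16) ^ m) q1).add q2).add q3)
  -- multiplying the trace by `(-16)ᵐ` makes its expansion integral
  have ht : ((-16 : ℂ) ^ m) * (-1 / 16) ^ m = 1 := by
    rw [← mul_pow]
    norm_num
  have h2 := congrArg (fun g : ℍ → ℂ => ((-16 : ℂ) ^ m) • g) h
  simp only [smul_add, smul_smul, ht, one_smul, smul_zero] at h2
  push_cast at h1
  rw [h2, ← map_add, ← map_add] at h1
  have h3 := toC_injective (h1.unique (Q := toC 0) fun z => by
    simpa using SumsTo.const 0 (Periodic.qParam 2 z))
  have h4 := congrArg modThree h3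
  have e8 : (Int.castRingHom (ZMod 3)) 8 = -1 := by decide
  have e192 : (Int.castRingHom (ZMod 3)) 192 = 0 := by decide
  have e16 : (Int.castRingHom (ZMod 3)) 16 = 1 := by decide
  have eA : modThree alphaSeries = alphaMod := rfl
  simp only [map_add, map_sub, map_mul, map_sum, map_pow, map_C, map_eisSeries, eA, e8, e192, e16,
    map_neg, map_one, map_zero, one_pow, mul_one, neg_mul, one_mul, zero_mul, sub_zero,
    add_zero] at h4
  rw [Finset.mul_sum, ← Finset.sum_add_distrib, ← Finset.sum_add_distrib] at h4
  have h5 : (-1 : PowerSeries (ZMod 3)) ^ m * ∑ j ∈ Finset.range (m + 1), C (c j : ZMod 3) *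
      (alphaMod ^ j + (alphaMod - 1) ^ j + (alphaMod + 1) ^ j) = 0 := by
    rw [Finset.mul_sum, ← h4]
    refine Finset.sum_congr rfl fun j hj => ?_
    have hjm : j ≤ m := Nat.lt_succ_iff.1 (Finset.mem_range.1 hj)
    have hm : (-1 : PowerSeries (ZMod 3)) ^ m = (-1) ^ j * (-1) ^ (m - j) := by
      rw [← pow_add, Nat.add_sub_cancel' hjm]
    have e1 : (1 + -alphaMod) ^ j = (-1) ^ j * (alphaMod - 1) ^ j := by
      rw [← mul_pow]; ring
    have e2 : (-alphaMod - 1) ^ j = (-1) ^ j * (alphaMod + 1) ^ j := by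
      rw [← mul_pow]; ring
    simp only [eq_intCast]
    rw [e1, e2, hm]
    ring
  have h6 := congrArg (fun x => (-1 : PowerSeries (ZMod 3)) ^ m * x) h5
  simp only [← mul_assoc, ← mul_pow] at h6
  simpa using h6

/-! ### Polynomials over `𝔽₃` and the subspace stable under the Hecke operators -/

/-- The polynomial `X - X³`, invariant under translation by `𝔽₃`. -/
def artinSchreier : Polynomial (ZMod 3) := Polynomial.X - Polynomial.X ^ 3

/-- The polynomial ring is generated by `1, X, X²` over the subring generated by `X - X³`. -/
lemma exists_eq_comp_artinSchreier (p : Polynomial (ZMod 3)) :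
    ∃ u v w : Polynomial (ZMod 3), p = u.comp artinSchreier +
      v.comp artinSchreier * Polynomial.X + w.comp artinSchreier * Polynomial.X ^ 2 := by
  induction p using Polynomial.induction_on with
  | C a => exact ⟨Polynomial.C a, 0, 0, by simp⟩
  | add p q hp hq =>
    obtain ⟨u, v, w, h⟩ := hp
    obtain ⟨u', v', w', h'⟩ := hq
    refine ⟨u + u', v + v', w + w', ?_⟩
    rw [h, h']
    simp only [Polynomial.add_comp]
    ring
  | monomial n a ih =>
    obtain ⟨u, v, w, h⟩ := ih
    refine ⟨-Polynomial.X * w, u + w, v, ?_⟩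
    rw [pow_succ, ← mul_assoc, h]
    simp only [Polynomial.add_comp, Polynomial.mul_comp, Polynomial.neg_comp, Polynomial.X_comp]
    rw [artinSchreier]
    ring

/-- The span over `𝔽₃` of all `D₂ᵏ` and `D₂ᵏ F³`. -/
def stableSpan : Submodule (ZMod 3) (PowerSeries (ZMod 3)) :=
  Submodule.span (ZMod 3) (Set.range (fun k => deltaMod ^ k) ∪
    Set.range fun k => deltaMod ^ k * alphaMod ^ 3)

lemma deltaMod_pow_mem (k : ℕ) : deltaMod ^ k ∈ stableSpan :=
  Submodule.subset_span (Or.inl ⟨k, rfl⟩)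

lemma deltaMod_pow_mul_alphaMod_mem (k : ℕ) : deltaMod ^ k * alphaMod ∈ stableSpan := by
  have h : deltaMod ^ k * alphaMod = deltaMod ^ k * alphaMod ^ 3 + deltaMod ^ (k + 1) := by
    rw [pow_succ deltaMod k, ← mul_add, deltaMod_eq]
    ring
  rw [h]
  exact add_mem (Submodule.subset_span (Or.inr ⟨k, rfl⟩)) (deltaMod_pow_mem _)

lemma aeval_mem_stableSpan (u : Polynomial (ZMod 3)) :
    Polynomial.aeval deltaMod u ∈ stableSpan := by
  rw [Polynomial.aeval_eq_sum_range]
  exact sum_mem fun i _ => Submodule.smul_mem _ _ (deltaMod_pow_mem i)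

lemma aeval_mul_alphaMod_mem_stableSpan (u : Polynomial (ZMod 3)) :
    Polynomial.aeval deltaMod u * alphaMod ∈ stableSpan := by
  rw [Polynomial.aeval_eq_sum_range, Finset.sum_mul]
  refine sum_mem fun i _ => ?_
  rw [smul_mul_assoc]
  exact Submodule.smul_mem _ _ (deltaMod_pow_mul_alphaMod_mem i)

lemma three_eq_zero : (3 : PowerSeries (ZMod 3)) = 0 := by
  rw [← map_ofNat (C (R := ZMod 3)) 3, show (OfNat.ofNat 3 : ZMod 3) = 0 from rfl, map_zero]

/-- A polynomial `p = u(D) + v(D) F + w(D) F²` has sum of translates `2 w(D)`, so that `w(D)`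
vanishes if the sum of translates does. -/
lemma mem_stableSpan_of_sum_translates (p : Polynomial (ZMod 3))
    (h : Polynomial.aeval alphaMod p + Polynomial.aeval (alphaMod - 1) p +
      Polynomial.aeval (alphaMod + 1) p = 0) : Polynomial.aeval alphaMod p ∈ stableSpan := by
  obtain ⟨u, v, w, rfl⟩ := exists_eq_comp_artinSchreier p
  have h3 := three_eq_zero
  have e0 : Polynomial.aeval alphaMod artinSchreier = deltaMod := by
    rw [deltaMod_eq]
    simp [artinSchreier]
  have e1 : Polynomial.aeval (alphaMod - 1) artinSchreier = deltaMod := by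
    rw [deltaMod_eq]
    simp only [artinSchreier, map_sub, map_pow, Polynomial.aeval_X]
    linear_combination (alphaMod ^ 2 - alphaMod) * h3
  have e2 : Polynomial.aeval (alphaMod + 1) artinSchreier = deltaMod := by
    rw [deltaMod_eq]
    simp only [artinSchreier, map_sub, map_pow, Polynomial.aeval_X]
    linear_combination (-alphaMod ^ 2 - alphaMod) * h3
  simp only [map_add, map_mul, map_pow, Polynomial.aeval_X, Polynomial.aeval_comp, e0, e1, e2]
    at h ⊢
  have hw : Polynomial.aeval deltaMod w = 0 := by
    linear_combination 2 * h - (2 * Polynomial.aeval deltaMod u +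
      2 * Polynomial.aeval deltaMod v * alphaMod + 2 * Polynomial.aeval deltaMod w * alphaMod ^ 2
      + Polynomial.aeval deltaMod w) * h3
  rw [hw, zero_mul, add_zero]
  exact add_mem (aeval_mem_stableSpan u) (aeval_mul_alphaMod_mem_stableSpan v)

/-- If the trace of a form vanishes, the Hecke operators map its reduction to `stableSpan`. -/
lemma heckeT_mem_stableSpan_of_traceST {l : ℕ} (hl : l.Prime) (hl2 : Odd l) (hl3 : ¬ 3 ∣ l)
    {m : ℕ} (hm : 1 ≤ m) {f : ℍ → ℂ} {P : PowerSeries ℤ} (hf : IsGammaTwoForm (2 * m) f)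
    (hP : HasQ f (toC P)) (h0 : traceST (2 * m) f = 0) :
    heckeT l (modThree P) ∈ stableSpan := by
  obtain ⟨Q, hQ, hQ3⟩ := exists_heckeT (k := 2 * m) (even_two_mul _) (by omega) hl3 P
  have hg := hf.heckeOp hl hl2
  have hgQ : HasQ (heckeOp (2 * m) l hl.pos f) (toC Q) := hQ ▸ hP.heckeOp hl.pos
  obtain ⟨c, hc⟩ := hg.exists_eq_sum m hgQ
  have ht := traceST_heckeOp hl hl2 hf h0
  rw [hc] at ht
  have hs := sum_translates_eq_zero c ht
  have hev : ∀ x : PowerSeries (ZMod 3), Polynomial.aeval x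
      (∑ j ∈ Finset.range (m + 1), Polynomial.C (c j : ZMod 3) * Polynomial.X ^ j) =
      ∑ j ∈ Finset.range (m + 1), C (c j : ZMod 3) * x ^ j := fun x => by
    rw [map_sum]
    refine Finset.sum_congr rfl fun j _ => ?_
    rw [map_mul, map_pow, Polynomial.aeval_X, Polynomial.aeval_C]
    rfl
  rw [← hQ3, modThree_eq_sum hgQ hc, ← hev]
  refine mem_stableSpan_of_sum_translates _ ?_
  rw [hev, hev, hev, ← hs, ← Finset.sum_add_distrib, ← Finset.sum_add_distrib]
  refine Finset.sum_congr rfl fun j _ => ?_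
  ring

/-- The Hecke operators preserve `stableSpan`: it is spanned by the reductions of `delta ^ k * eis`,
and of differences of `delta ^ k * alpha` and these, all of which have vanishing trace. -/
lemma heckeT_mem_stableSpan {l : ℕ} (hl : l.Prime) (hl2 : Odd l) (hl3 : ¬ 3 ∣ l)
    {φ : PowerSeries (ZMod 3)} (hφ : φ ∈ stableSpan) : heckeT l φ ∈ stableSpan := by
  have key : ∀ (k : ℕ) {f : ℍ → ℂ} {P : PowerSeries ℤ}, IsGammaTwoForm 2 f → HasQ f (toC P) →
      traceST 2 f = 0 → heckeT l (deltaMod ^ k * modThree P) ∈ stableSpan := by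
    intro k f P hf hP h0
    have hk : (k : ℤ) * 6 + 2 = 2 * ((3 * k + 1 : ℕ) : ℤ) := by push_cast; ring
    have h1 := ((isGammaTwoForm_delta.pow k).mul hf).congr hk
    have h2 : HasQ (delta ^ k * f) (toC (deltaSeries ^ k * P)) := by
      rw [map_mul, map_pow]
      exact (hasQ_delta.pow k).mul hP
    have h3 := traceST_delta_pow_mul k h0
    rw [hk] at h3
    have := heckeT_mem_stableSpan_of_traceST hl hl2 hl3 (by omega) h1 h2 h3
    rwa [map_mul, map_pow] at this
  have key1 : ∀ k, heckeT l (deltaMod ^ k) ∈ stableSpan := fun k => by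
    have := key k isGammaTwoForm_eis hasQ_eis traceST_eis
    rwa [map_eisSeries, mul_one] at this
  rw [stableSpan] at hφ
  induction hφ using Submodule.span_induction with
  | mem x hx =>
    rcases hx with ⟨k, rfl⟩ | ⟨k, rfl⟩
    · exact key1 k
    · have h : deltaMod ^ k * alphaMod ^ 3 = deltaMod ^ k * alphaMod - deltaMod ^ (k + 1) := by
        rw [pow_succ deltaMod k, ← mul_sub, deltaMod_eq]
        ring
      simp only [h, map_sub]
      exact sub_mem (key k isGammaTwoForm_alpha hasQ_alpha traceST_alpha) (key1 _)
  | zero => simp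
  | add x y _ _ hx hy =>
    rw [map_add]
    exact add_mem hx hy
  | smul a x _ hx =>
    rw [map_smul]
    exact Submodule.smul_mem _ _ hx

/-! ### Exponents modulo six -/

/-- Only exponents in the residue class `r` modulo `6` occur in `f`. -/
def ExpIn (r : ZMod 6) (f : PowerSeries (ZMod 3)) : Prop :=
  ∀ n, coeff n f ≠ 0 → (n : ZMod 6) = r

namespace ExpIn

variable {r s : ZMod 6} {f g : PowerSeries (ZMod 3)}

lemma mul (hf : ExpIn r f) (hg : ExpIn s g) : ExpIn (r + s) (f * g) := fun n hn => by
  rw [coeff_mul] at hn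
  obtain ⟨⟨i, j⟩, hij, h⟩ := Finset.exists_ne_zero_of_sum_ne_zero hn
  rw [Finset.HasAntidiagonal.mem_antidiagonal] at hij
  rw [← hij, Nat.cast_add, hf i (left_ne_zero_of_mul h), hg j (right_ne_zero_of_mul h)]

lemma one : ExpIn 0 1 := fun n hn => by
  rw [coeff_one] at hn
  have : n = 0 := by by_contra h; simp [h] at hn
  simp [this]

lemma pow (hf : ExpIn r f) (k : ℕ) : ExpIn (k * r) (f ^ k) := by
  induction k with
  | zero => simpa using one
  | succ k ih =>
    rw [pow_succ]
    have := ih.mul hf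
    rwa [show ((k + 1 : ℕ) : ZMod 6) * r = k * r + r by push_cast; ring]

lemma X_pow (k : ℕ) : ExpIn k (PowerSeries.X ^ k) := fun n hn => by
  rw [coeff_X_pow] at hn
  have : n = k := by by_contra h; simp [h] at hn
  rw [this]

lemma expand_six (f : PowerSeries (ZMod 3)) :
    ExpIn 0 (PowerSeries.expand 6 (by norm_num) f) := fun n hn => by
  by_contra h
  rw [ZMod.natCast_eq_zero_iff] at h
  exact hn (coeff_expand_of_not_dvd _ _ _ h)

/-- The Hecke operator multiplies the residue class of the exponents by `l`. -/
lemma heckeT (hf : ExpIn r f) {l : ℕ} (hl : (l : ZMod 6) ^ 2 = 1) :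
    ExpIn (l * r) (heckeT l f) := fun n hn => by
  simp only [ModThree.heckeT, heckeWeight, LinearMap.coe_mk, AddHom.coe_mk, coeff_mk] at hn
  by_cases h1 : coeff (l * n) f = 0
  · rw [h1, zero_add] at hn
    have h2 := right_ne_zero_of_mul hn
    split_ifs at h2 with hd
    · obtain ⟨m, rfl⟩ := hd
      have hl0 : 0 < l := by
        rcases Nat.eq_zero_or_pos l with rfl | h
        · exact absurd hl (by decide)
        · exact h
      rw [Nat.mul_div_cancel_left _ hl0] at h2
      rw [Nat.cast_mul, hf m h2]
    · exact absurd rfl h2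
  · rw [← hf _ h1, Nat.cast_mul, ← mul_assoc, ← sq, hl, one_mul]

end ExpIn

lemma cube_eq_expand (f : PowerSeries (ZMod 3)) :
    f ^ 3 = PowerSeries.expand 3 (by norm_num) f := by
  have h := MvPowerSeries.map_frobenius_expand 3 (by norm_num)
    (f := (f : MvPowerSeries Unit (ZMod 3)))
  rw [ZMod.frobenius_zmod, MvPowerSeries.map_id] at h
  exact h.symm

lemma expIn_expand_two_cube (f : PowerSeries ℤ) :
    ExpIn 0 (modThree (PowerSeries.expand 2 two_ne_zero f) ^ 3) := by
  rw [cube_eq_expand, PowerSeries.map_expand, ← PowerSeries.expand_mul]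
  exact ExpIn.expand_six _

lemma expIn_deltaMod : ExpIn 1 deltaMod := by
  have h : deltaMod = PowerSeries.X ^ 1 *
      modThree (PowerSeries.expand 2 two_ne_zero (eulerSeries ^ 4)) ^ 3 := by
    simp only [deltaMod, deltaSeries, map_mul, PowerSeries.map_X, map_pow, ← pow_mul, pow_one]
  have h2 := (ExpIn.X_pow 1).mul (expIn_expand_two_cube (eulerSeries ^ 4))
  rwa [← h, Nat.cast_one, add_zero] at h2

lemma expIn_alphaMod_cube : ExpIn 3 (alphaMod ^ 3) := by
  rw [alphaMod, alphaSeries, map_mul, PowerSeries.map_X, mul_pow]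
  have h2 := (ExpIn.X_pow 3).mul (expIn_expand_two_cube alphaUnit)
  rwa [add_zero] at h2

/-! ### Passage from `Γ(2)` to `Γ₀(4)` -/

lemma slash_dbl (k : ℤ) (f : ℍ → ℂ) :
    f ∣[k] upperTri 2 0 1 two_pos one_pos = fun z => (2 : ℂ) ^ (k - 1) * f (dbl z) := by
  funext z
  have : affinePt 2 0 1 two_pos one_pos z = dbl z := by
    ext
    simp [affinePt, dbl]
  rw [slash_upperTri, this]
  simp

/-- Conjugation by `(2, 0; 0, 1)` maps `Γ₀(4)` into `Γ(2)`. -/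
lemma exists_mul_upperTri {x : GL (Fin 2) ℝ} (hx : x ∈ Gamma0GL 4) :
    ∃ γ ∈ Gamma 2, upperTri 2 0 1 two_pos one_pos * x =
      (γ : GL (Fin 2) ℝ) * upperTri 2 0 1 two_pos one_pos := by
  obtain ⟨γ, hγ, rfl⟩ := hx
  have h10 : ((γ 1 0 : ℤ) : ZMod 4) = 0 := Gamma0_mem.1 hγ
  obtain ⟨c, hc⟩ := (ZMod.intCast_zmod_eq_zero_iff_dvd _ _).1 h10
  have hdet := γ.2
  rw [Matrix.det_fin_two] at hdet
  have hc' : γ.1 1 0 = 4 * c := hc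
  rw [hc'] at hdet
  have hodd : Odd (γ.1 0 0 * γ.1 1 1) := ⟨2 * (γ.1 0 1 * c), by linear_combination hdet⟩
  obtain ⟨γ', h⟩ : ∃ γ' : SL(2, ℤ), γ'.1 = !![γ.1 0 0, 2 * γ.1 0 1; 2 * c, γ.1 1 1] :=
    ⟨⟨_, by rw [Matrix.det_fin_two_of]; linear_combination hdet⟩, rfl⟩
  refine ⟨γ', ?_, ?_⟩
  · rw [mem_gammaTwo_iff, h]
    exact ⟨(Int.odd_mul.1 hodd).1, even_two_mul _, even_two_mul _, (Int.odd_mul.1 hodd).2⟩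
  · have hcr : ((γ.1 1 0 : ℤ) : ℝ) = 4 * c := by rw [hc']; push_cast; ring
    ext i j
    fin_cases i <;> fin_cases j <;>
      simp [upperTri, Matrix.GeneralLinearGroup.mkOfDetNeZero, Matrix.mul_apply, Fin.sum_univ_two,
        hcr, h] <;> ring

open Pointwise in
/-- Substituting `2z` in a form for `Γ(2)` gives a form for `Γ₀(4)`. -/
lemma IsGammaTwoForm.exists_modularForm {k : ℤ} {f : ℍ → ℂ} (hf : IsGammaTwoForm k f) :
    ∃ g : ModularForm (Gamma0GL 4) k, ∀ z, g z = f (dbl z) := by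
  set δ := upperTri 2 0 1 two_pos one_pos with hδ
  have hle : Gamma0GL 4 ≤ ConjAct.toConjAct δ⁻¹ • GammaTwoGL := fun x hx => by
    obtain ⟨γ, hγ, h⟩ := exists_mul_upperTri hx
    rw [Subgroup.mem_pointwise_smul_iff_inv_smul_mem, ← ConjAct.toConjAct_inv, inv_inv,
      ConjAct.toConjAct_smul, h, mul_inv_cancel_right]
    exact ⟨γ, hγ, rfl⟩
  set g0 := ModularForm.translate hf.toModularForm δ with hg0
  have hcoe : (g0 : ℍ → ℂ) = fun z => (2 : ℂ) ^ (k - 1) * f (dbl z) := slash_dbl k f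
  let g1 : ModularForm (Gamma0GL 4) k :=
    { toFun := g0
      slash_action_eq' := fun γ hγ => g0.slash_action_eq' γ (hle hγ)
      holo' := g0.holo'
      bdd_at_cusps' := fun hc => g0.bdd_at_cusps' (hc.mono hle) }
  refine ⟨((2 : ℂ) ^ (k - 1))⁻¹ • g1, fun z => ?_⟩
  have h2 : ((2 : ℂ) ^ (k - 1)) ≠ 0 := zpow_ne_zero _ two_ne_zero
  change ((2 : ℂ) ^ (k - 1))⁻¹ * (g0 : ℍ → ℂ) z = _
  rw [hcoe, inv_mul_cancel_left₀ h2]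

lemma hasSum_dbl {f : ℍ → ℂ} {P : PowerSeries ℂ} (hP : HasQ f P) (z : ℍ) :
    HasSum (fun n => coeff n P • Periodic.qParam 1 z ^ n) (f (dbl z)) := by
  have h := hP (dbl z)
  have e : Periodic.qParam 2 (dbl z) = Periodic.qParam 1 z := by
    simpa [dbl] using qParam_mul_right two_ne_zero 1 z
  rw [e] at h
  exact h

/-- The expansion of `f(2z)` in powers of `exp(2π i z)` is that of `f` in powers of `exp(π i z)`. -/
lemma IsGammaTwoForm.qExpansion_dbl {k : ℤ} {f : ℍ → ℂ} (hf : IsGammaTwoForm k f)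
    {P : PowerSeries ℂ} (hP : HasQ f P) : qExpansion 1 (fun z => f (dbl z)) = P := by
  obtain ⟨g, hg⟩ := hf.exists_modularForm
  have hg' : (g : ℍ → ℂ) = fun z => f (dbl z) := funext hg
  ext n
  rw [← hg']
  refine (ModularFormClass.qExpansion_coeff_unique (Γ := Gamma0GL 4) (f := g)
    (c := fun n => coeff n P) one_pos (by simp) (fun z => ?_) n).symm
  rw [hg]
  exact hasSum_dbl hP z

lemma isPIntegral_toC (P : PowerSeries ℤ) (n : ℕ) : IsPIntegral 3 (coeff n (toC P)) :=
  ⟨(coeff n P : ℤ), by simp, by simp⟩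

lemma redSeries_toC (P : PowerSeries ℤ) : redSeries 3 (toC P) = modThree P := by
  ext n
  have h := redCoeff_ratCast 3 ((coeff n P : ℤ) : ℚ) (by simp)
  rw [redSeries, coeff_mk, PowerSeries.coeff_map, PowerSeries.coeff_map]
  simpa using h

lemma IsGammaTwoForm.modThree_mem {k : ℤ} {f : ℍ → ℂ} (hf : IsGammaTwoForm k f)
    {P : PowerSeries ℤ} (hP : HasQ f (toC P)) : modThree P ∈ modFormsMod 3 4 := by
  refine Submodule.mem_iSup_of_mem k (Submodule.subset_span ?_)
  obtain ⟨g, hg⟩ := hf.exists_modularForm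
  have hg' : qExpansion 1 (g : ℍ → ℂ) = toC P := by
    rw [← hf.qExpansion_dbl hP]
    exact congrArg _ (funext hg)
  refine ⟨g, fun n => ?_, ?_⟩
  · rw [hg']
    exact isPIntegral_toC P n
  · rw [hg', redSeries_toC]

lemma D2bar_eq : D2bar = deltaMod := by
  have h : D2 = fun z => delta (dbl z) := rfl
  rw [D2bar, h, isGammaTwoForm_delta.qExpansion_dbl hasQ_delta, redSeries_toC]
  rfl

lemma Fbar_eq : Fbar = alphaMod := by
  have h : F = fun z => alpha (dbl z) := by
    funext z
    simp only [F, alpha, dbl, UpperHalfPlane.coe_mk]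
    rw [← mul_assoc]
    norm_num
  rw [Fbar, h, isGammaTwoForm_alpha.qExpansion_dbl hasQ_alpha, redSeries_toC]
  rfl

lemma deltaMod_pow_mul_alphaMod_pow_mem (i j : ℕ) :
    deltaMod ^ i * alphaMod ^ j ∈ modFormsMod 3 4 := by
  have h := ((isGammaTwoForm_delta.pow i).mul (isGammaTwoForm_alpha.pow j)).modThree_mem
    (P := deltaSeries ^ i * alphaSeries ^ j) (by
      rw [map_mul, map_pow, map_pow]
      exact (hasQ_delta.pow i).mul (hasQ_alpha.pow j))
  rwa [map_mul, map_pow, map_pow] at h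

/-! ### The subspaces `W1` and `W5` -/

/-- The part of `stableSpan` with exponents in the residue class `r` modulo `6`. -/
def classPart (r : ℕ) : Submodule (ZMod 3) (PowerSeries (ZMod 3)) :=
  Submodule.span (ZMod 3)
    ({φ | ∃ k : ℕ, k ≡ r [MOD 6] ∧ φ = deltaMod ^ k} ∪
      {φ | ∃ i : ℕ, i ≡ r + 3 [MOD 6] ∧ φ = deltaMod ^ i * alphaMod ^ 3})

lemma W1_eq : W1 = classPart 1 := by
  rw [W1, classPart, D2bar_eq, Fbar_eq]

lemma W5_eq : W5 = classPart 5 := by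
  rw [W5, classPart, D2bar_eq, Fbar_eq]
  have : ∀ i, i ≡ 2 [MOD 6] ↔ i ≡ 5 + 3 [MOD 6] := fun i => by
    simp only [Nat.ModEq]
  simp only [this]

lemma classPart_le_modFormsMod (r : ℕ) : classPart r ≤ modFormsMod 3 4 := by
  refine Submodule.span_le.2 ?_
  rintro _ (⟨k, -, rfl⟩ | ⟨i, -, rfl⟩)
  · simpa using deltaMod_pow_mul_alphaMod_pow_mem k 0
  · exact deltaMod_pow_mul_alphaMod_pow_mem i 3

lemma classPart_le_stableSpan (r : ℕ) : classPart r ≤ stableSpan := by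
  refine Submodule.span_le.2 ?_
  rintro _ (⟨k, -, rfl⟩ | ⟨i, -, rfl⟩)
  · exact deltaMod_pow_mem k
  · exact Submodule.subset_span (Or.inr ⟨i, rfl⟩)

lemma expIn_deltaMod_pow (k : ℕ) : ExpIn k (deltaMod ^ k) := by
  simpa using expIn_deltaMod.pow k

lemma expIn_deltaMod_pow_mul (i : ℕ) : ExpIn (i + 3) (deltaMod ^ i * alphaMod ^ 3) :=
  (expIn_deltaMod_pow i).mul expIn_alphaMod_cube

/-- The projection of power series onto the exponents in the residue class `r` modulo `6`. -/
def projClass (r : ZMod 6) : PowerSeries (ZMod 3) →ₗ[ZMod 3] PowerSeries (ZMod 3) where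
  toFun f := PowerSeries.mk fun n => if (n : ZMod 6) = r then coeff n f else 0
  map_add' f g := by
    ext n
    simp only [coeff_mk, map_add]
    split_ifs <;> simp
  map_smul' a f := by
    ext n
    simp

lemma projClass_of_expIn {r s : ZMod 6} {f : PowerSeries (ZMod 3)} (hf : ExpIn s f) :
    projClass r f = if s = r then f else 0 := by
  ext n
  simp only [projClass, LinearMap.coe_mk, AddHom.coe_mk, coeff_mk]
  by_cases h : coeff n f = 0
  · split_ifs <;> simp [h]
  · rw [hf n h]
    split_ifs <;> simp

lemma expIn_iff {r : ZMod 6} {f : PowerSeries (ZMod 3)} : ExpIn r f ↔ projClass r f = f := by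
  refine ⟨fun h => by simp [projClass_of_expIn h], fun h n hn => ?_⟩
  by_contra h'
  apply hn
  rw [← h]
  simp [projClass, h']

lemma projClass_mem_classPart (r : ℕ) {f : PowerSeries (ZMod 3)} (hf : f ∈ stableSpan) :
    projClass r f ∈ classPart r := by
  rw [stableSpan] at hf
  induction hf using Submodule.span_induction with
  | mem x hx =>
    rcases hx with ⟨k, rfl⟩ | ⟨k, rfl⟩
    · simp only
      rw [projClass_of_expIn (expIn_deltaMod_pow k)]
      split_ifs with h
      · exact Submodule.subset_span (Or.inl ⟨k, (ZMod.natCast_eq_natCast_iff _ _ _).1 h, rfl⟩)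
      · exact zero_mem _
    · simp only
      rw [projClass_of_expIn (expIn_deltaMod_pow_mul k)]
      split_ifs with h
      · refine Submodule.subset_span (Or.inr ⟨k, (ZMod.natCast_eq_natCast_iff _ _ _).1 ?_, rfl⟩)
        have h6 : (6 : ZMod 6) = 0 := rfl
        push_cast
        linear_combination h - h6
      · exact zero_mem _
  | zero => simp
  | add x y _ _ hx hy =>
    rw [map_add]
    exact add_mem hx hy
  | smul a x _ hx =>
    rw [map_smul]
    exact Submodule.smul_mem _ _ hx

lemma expIn_of_mem_classPart (r : ℕ) {f : PowerSeries (ZMod 3)} (hf : f ∈ classPart r) :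
    ExpIn r f := by
  rw [expIn_iff]
  rw [classPart] at hf
  induction hf using Submodule.span_induction with
  | mem x hx =>
    rw [← expIn_iff]
    rcases hx with ⟨k, hk, rfl⟩ | ⟨k, hk, rfl⟩
    · rw [← (ZMod.natCast_eq_natCast_iff _ _ _).2 hk]
      exact expIn_deltaMod_pow k
    · have h := (ZMod.natCast_eq_natCast_iff _ _ _).2 hk
      have h6 : (6 : ZMod 6) = 0 := rfl
      have hr : (r : ZMod 6) = k + 3 := by
        push_cast at h
        linear_combination -h - h6
      rw [hr]
      exact expIn_deltaMod_pow_mul k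
  | zero => simp
  | add x y _ _ hx hy => rw [map_add, hx, hy]
  | smul a x _ hx => rw [map_smul, hx]

/-- The Hecke operator `T_l` maps the part of class `r` to the part of class `l r`. -/
lemma heckeT_mem_classPart {l : ℕ} (hl : l.Prime) (hl6 : (l : ZMod 6) ^ 2 = 1) {r s : ℕ}
    (hrs : (l * r : ZMod 6) = s) {f : PowerSeries (ZMod 3)} (hf : f ∈ classPart r) :
    heckeT l f ∈ classPart s := by
  have hl2 : Odd l := by
    rcases hl.eq_two_or_odd' with rfl | h
    · exact absurd hl6 (by decide)
    · exact h
  have hl3 : ¬ 3 ∣ l := fun h => by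
    rw [Nat.prime_dvd_prime_iff_eq Nat.prime_three hl] at h
    subst h
    exact absurd hl6 (by decide)
  have h1 := (expIn_of_mem_classPart r hf).heckeT hl6
  rw [hrs, expIn_iff] at h1
  rw [← h1]
  exact projClass_mem_classPart s (heckeT_mem_stableSpan hl hl2 hl3 (classPart_le_stableSpan r hf))

end ModThree

end

theorem theorem3 :
    (ModThree.W1 ≤ ModThree.modFormsMod 3 4 ∧ ModThree.W5 ≤ ModThree.modFormsMod 3 4) ∧
    ∀ l : ℕ, l.Prime →
      (l ≡ 1 [MOD 6] →
        (∀ f ∈ ModThree.W1, ModThree.heckeT' l f ∈ ModThree.W1) ∧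
        (∀ f ∈ ModThree.W5, ModThree.heckeT' l f ∈ ModThree.W5)) ∧
      (l ≡ 5 [MOD 6] →
        (∀ f ∈ ModThree.W1, ModThree.heckeT' l f ∈ ModThree.W5) ∧
        (∀ f ∈ ModThree.W5, ModThree.heckeT' l f ∈ ModThree.W1)) := by
  rw [ModThree.W1_eq, ModThree.W5_eq]
  refine ⟨⟨ModThree.classPart_le_modFormsMod 1, ModThree.classPart_le_modFormsMod 5⟩,
    fun l hl => ⟨fun h => ?_, fun h => ?_⟩⟩
  · have h3 : l ≡ 1 [MOD 3] := h.of_dvd (by norm_num)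
    have h6 : (l : ZMod 6) = 1 := by exact_mod_cast (ZMod.natCast_eq_natCast_iff _ _ _).2 h
    have key : ∀ r : ℕ, ∀ f ∈ ModThree.classPart r,
        ModThree.heckeT' l f ∈ ModThree.classPart r := by
      intro r f hf
      rw [ModThree.heckeT', if_pos h3]
      refine sub_mem (ModThree.heckeT_mem_classPart hl (by rw [h6, one_pow]) ?_ hf)
        (Submodule.smul_mem _ _ hf)
      rw [h6, one_mul]
    exact ⟨key 1, key 5⟩
  · have h3 : ¬ l ≡ 1 [MOD 3] := by
      have : l ≡ 5 [MOD 3] := h.of_dvd (by norm_num)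
      simp only [Nat.ModEq] at this ⊢
      omega
    have h6 : (l : ZMod 6) = 5 := by exact_mod_cast (ZMod.natCast_eq_natCast_iff _ _ _).2 h
    have h2 : (l : ZMod 6) ^ 2 = 1 := by rw [h6]; decide
    rw [ModThree.heckeT', if_neg h3]
    refine ⟨fun f hf => ModThree.heckeT_mem_classPart hl h2 ?_ hf,
      fun f hf => ModThree.heckeT_mem_classPart hl h2 ?_ hf⟩
    · rw [h6]; decide
    · rw [h6]; decide
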